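/- Let $\mathbf Z^2_+=\{(n,m)\in\mathbf Z^2: n,m\ge 0\}$. For a map $f$ on $\mathbf Z^2_+$ consider the cross-ratio equation on all elementary quadrilaterals $$\frac{(f_{n,m}-f_{n+1,m})(f_{n+1,m+1}-f_{n,m+1})}{(f_{n+1,m}-f_{n+1,m+1})(f_{n,m+1}-f_{n,m})}=-1,\qquad (1)$$ and, with the abbreviation $$S^{a,b}_{n,m}(f)=a\,n\,\frac{(f_{n+1,m}-f_{n,m})(f_{n,m}-f_{n-1,m})}{f_{n+1,m}-f_{n-1,m}}+b\,m\,\frac{(f_{n,m+1}-f_{n,m})(f_{n,m}-f_{n,m-1})}{f_{n,m+1}-f_{n,m-1}},$$ the constraints $$\gamma f_{n,m}=S^{2,2}_{n,m}(f)\qquad (2)\qquad\text{and}\qquad 1=S^{1,1}_{n,m}(f).\qquad (3)$$ Terms with $n=0$ or $m=0$ are absent from the constraints, and all equations are understood to be regularized through multiplication by their denominators (for maps to the Riemann sphere, in homogeneous coordinates). The discrete map $Z^2:\mathbf Z^2_+\to\mathbf C$ is the solution of (1) and of (2) with $\gamma=2$ at all points of $\mathbf Z^2_+$, with $$Z^2(0,0)=Z^2(1,0)=Z^2(0,1)=0,\quad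 Z^2(2,0)=1,\quad Z^2(0,2)=-1,\quad Z^2(1,1)=\tfrac{2i}{\pi}.$$ The discrete map $\mathrm{Log}:\mathbf Z^2_+\to\mathbf C\cup\{\infty\}$ is the solution of (1) and of (3) at all points of $\mathbf Z^2_+\setminus\{(0,0)\}$, with $$\mathrm{Log}(0,0)=\infty,\quad \mathrm{Log}(1,0)=0,\quad \mathrm{Log}(0,1)=i\pi,\quad \mathrm{Log}(2,0)=1,\quad \mathrm{Log}(0,2)=1+i\pi,\quad \mathrm{Log}(1,1)=\tfrac{i\pi}{2}.$$ A map is called an immersion if the interiors of any two different adjacent (having a common edge or vertex) elementary quadrilaterals $(f_{n,m},f_{n+1,m},f_{n+1,m+1},f_{n,m+1})$ are disjoint. (The quadrilateral of $\mathrm{Log}$ with the vertex $\infty$ is the half-strip $\{\operatorname{Re} w\le 0,\ 0\le\operatorname{Im} w\le\pi\}$.) Proposition. The maps $Z^2$ and $\mathrm{Log}$ exist and are uniquely determined by these conditions, and both are immersions. Moreover, $\mathrm{Log}$ corresponds to the circle pattern dual to that of $Z^2$: for every $(n,m)\ne(0,0)$ with $n+m$ even, the images under $Z^2$ of the lattice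 neighbors of $(n,m)$ in $\mathbf Z^2_+$ lie on a circle with center $Z^2(n,m)$ and some radius $R_{Z^2}>0$, and their images under $\mathrm{Log}$ lie on a circle with center $\mathrm{Log}(n,m)$ and radius $R_{\mathrm{Log}}=1/R_{Z^2}$. -/

import Mathlib

namespace DiscreteConformal

/-! A map on the quadrant `ℤ²₊` is a function of two natural numbers `n`, `m`. -/

/-- The cross-ratio equation `q(f n m, f (n+1) m, f (n+1) (m+1), f n (m+1)) = -1` for all
elementary quadrilaterals, multiplied by its denominator. -/
def CrossRatioEq (f : ℕ → ℕ → ℂ) : Prop :=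
  ∀ n m : ℕ,
    (f n m - f (n + 1) m) * (f (n + 1) (m + 1) - f n (m + 1)) =
      -((f (n + 1) m - f (n + 1) (m + 1)) * (f n (m + 1) - f n m))

/-- The nonautonomous constraint
`γ f = 2 n (f₁ - f) (f - f₋₁) / (f₁ - f₋₁) + 2 m (f₂ - f) (f - f₋₂) / (f₂ - f₋₂)`
at every point of the quadrant, multiplied by its denominators. A term whose factor `n` or `m`
is zero is absent, together with its denominator. -/
structure Constraint (γ : ℂ) (f : ℕ → ℕ → ℂ) : Prop where
  origin : γ * f 0 0 = 0
  horizontal : ∀ n : ℕ,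
    γ * f (n + 1) 0 * (f (n + 2) 0 - f n 0) =
      2 * ((n + 1 : ℕ) : ℂ) * (f (n + 2) 0 - f (n + 1) 0) * (f (n + 1) 0 - f n 0)
  vertical : ∀ m : ℕ,
    γ * f 0 (m + 1) * (f 0 (m + 2) - f 0 m) =
      2 * ((m + 1 : ℕ) : ℂ) * (f 0 (m + 2) - f 0 (m + 1)) * (f 0 (m + 1) - f 0 m)
  inner : ∀ n m : ℕ,
    γ * f (n + 1) (m + 1) *
        (f (n + 2) (m + 1) - f n (m + 1)) * (f (n + 1) (m + 2) - f (n + 1) m) =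
      2 * ((n + 1 : ℕ) : ℂ) * (f (n + 2) (m + 1) - f (n + 1) (m + 1)) *
          (f (n + 1) (m + 1) - f n (m + 1)) * (f (n + 1) (m + 2) - f (n + 1) m) +
        2 * ((m + 1 : ℕ) : ℂ) * (f (n + 1) (m + 2) - f (n + 1) (m + 1)) *
          (f (n + 1) (m + 1) - f (n + 1) m) * (f (n + 2) (m + 1) - f n (m + 1))

/-- `f` is the discrete `z²`. -/
structure IsZ2 (f : ℕ → ℕ → ℂ) : Prop where
  crossRatio : CrossRatioEq f
  constraint : Constraint 2 f
  init00 : f 0 0 = 0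
  init10 : f 1 0 = 0
  init01 : f 0 1 = 0
  init20 : f 2 0 = 1
  init02 : f 0 2 = -1
  init11 : f 1 1 = Complex.I * (2 / Real.pi)

/-- First homogeneous coordinate of a point of the Riemann sphere (`z` is `[z : 1]`, `∞` is
`[1 : 0]`). -/
def num (p : OnePoint ℂ) : ℂ := p.elim 1 id

/-- Second homogeneous coordinate of a point of the Riemann sphere. -/
def den (p : OnePoint ℂ) : ℂ := p.elim 0 (fun _ => 1)

/-- The difference of two points of the sphere in homogeneous form: it is `z - w` for finite
`z`, `w`, and `1` and `-1` for `(∞, w)` and `(z, ∞)`. -/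
def hdiff (p q : OnePoint ℂ) : ℂ := num p * den q - num q * den p

theorem hdiff_coe (z w : ℂ) : hdiff (z : OnePoint ℂ) (w : OnePoint ℂ) = z - w := by
  simp [hdiff, num, den]

/-- The cross-ratio equation for a map to the Riemann sphere, multiplied by its denominator.
Each vertex enters both sides with the same degree, so this does not depend on the choice of the
homogeneous coordinates; for finite values it is `CrossRatioEq`. -/
def SphereCrossRatioEq (g : ℕ → ℕ → OnePoint ℂ) : Prop :=
  ∀ n m : ℕ,
    hdiff (g n m) (g (n + 1) m) * hdiff (g (n + 1) (m + 1)) (g n (m + 1)) =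
      -(hdiff (g (n + 1) m) (g (n + 1) (m + 1)) * hdiff (g n (m + 1)) (g n m))

/-- The constraint `1 = n (g₁ - g) (g - g₋₁) / (g₁ - g₋₁) + m (g₂ - g) (g - g₋₂) / (g₂ - g₋₂)` at
every point of the quadrant except the origin, for a map to the Riemann sphere, in homogeneous
coordinates and multiplied by its denominators. A term whose factor `n` or `m` is zero is absent,
together with its denominator. -/
structure LogConstraint (g : ℕ → ℕ → OnePoint ℂ) : Prop where
  horizontal : ∀ n : ℕ,
    den (g (n + 1) 0) ^ 2 * hdiff (g (n + 2) 0) (g n 0) =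
      ((n + 1 : ℕ) : ℂ) * hdiff (g (n + 2) 0) (g (n + 1) 0) * hdiff (g (n + 1) 0) (g n 0)
  vertical : ∀ m : ℕ,
    den (g 0 (m + 1)) ^ 2 * hdiff (g 0 (m + 2)) (g 0 m) =
      ((m + 1 : ℕ) : ℂ) * hdiff (g 0 (m + 2)) (g 0 (m + 1)) * hdiff (g 0 (m + 1)) (g 0 m)
  inner : ∀ n m : ℕ,
    den (g (n + 1) (m + 1)) ^ 2 *
        hdiff (g (n + 2) (m + 1)) (g n (m + 1)) * hdiff (g (n + 1) (m + 2)) (g (n + 1) m) =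
      ((n + 1 : ℕ) : ℂ) * hdiff (g (n + 2) (m + 1)) (g (n + 1) (m + 1)) *
          hdiff (g (n + 1) (m + 1)) (g n (m + 1)) * hdiff (g (n + 1) (m + 2)) (g (n + 1) m) +
        ((m + 1 : ℕ) : ℂ) * hdiff (g (n + 1) (m + 2)) (g (n + 1) (m + 1)) *
          hdiff (g (n + 1) (m + 1)) (g (n + 1) m) * hdiff (g (n + 2) (m + 1)) (g n (m + 1))

/-- `g` is the discrete logarithm. -/
structure IsLog (g : ℕ → ℕ → OnePoint ℂ) : Prop where
  crossRatio : SphereCrossRatioEq g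
  constraint : LogConstraint g
  init00 : g 0 0 = OnePoint.infty
  init10 : g 1 0 = ((0 : ℂ) : OnePoint ℂ)
  init01 : g 0 1 = ((Complex.I * Real.pi : ℂ) : OnePoint ℂ)
  init20 : g 2 0 = ((1 : ℂ) : OnePoint ℂ)
  init02 : g 0 2 = ((1 + Complex.I * Real.pi : ℂ) : OnePoint ℂ)
  init11 : g 1 1 = ((Complex.I * (Real.pi / 2) : ℂ) : OnePoint ℂ)

/-- The closed half-strip over the segment `[p, q]`, on the left of the directed segment from `p` to
`q`, that is, in the direction `i (q - p)`. -/
def halfStrip (p q : ℂ) : Set ℂ :=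
  {w | ∃ s ∈ Set.Icc (0 : ℝ) 1, ∃ t : ℝ, 0 ≤ t ∧ w = p + s * (q - p) + t * (Complex.I * (q - p))}

/-- The closed quadrilateral with consecutive vertices `a`, `b`, `c`, `d`. Four distinct points
with cross-ratio `-1` lie on a circle in this cyclic order, so the quadrilateral is their convex
hull. If one vertex is at infinity (the limit of positively oriented kites whose center tends to
infinity), it is the half-strip over the segment from the next to the previous vertex, on the side
given by the positive orientation. Two vertices at infinity do not occur. -/
def quad : OnePoint ℂ → OnePoint ℂ → OnePoint ℂ → OnePoint ℂ → Set ℂ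
  | OnePoint.some a, OnePoint.some b, OnePoint.some c, OnePoint.some d =>
      convexHull ℝ {a, b, c, d}
  | OnePoint.infty, OnePoint.some b, OnePoint.some _, OnePoint.some d => halfStrip b d
  | OnePoint.some a, OnePoint.infty, OnePoint.some c, OnePoint.some _ => halfStrip c a
  | OnePoint.some _, OnePoint.some b, OnePoint.infty, OnePoint.some d => halfStrip d b
  | OnePoint.some a, OnePoint.some _, OnePoint.some c, OnePoint.infty => halfStrip a c
  | _, _, _, _ => Set.univ

/-- The elementary quadrilateral of `g` at `(n, m)`. -/
def cell (g : ℕ → ℕ → OnePoint ℂ) (n m : ℕ) : Set ℂ :=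
  quad (g n m) (g (n + 1) m) (g (n + 1) (m + 1)) (g n (m + 1))

/-- Two different elementary squares of the lattice that share an edge or a vertex. -/
def AdjacentCells (n m k l : ℕ) : Prop :=
  (n, m) ≠ (k, l) ∧ n ≤ k + 1 ∧ k ≤ n + 1 ∧ m ≤ l + 1 ∧ l ≤ m + 1

/-- The interiors of adjacent elementary quadrilaterals are disjoint. -/
def IsImmersion (g : ℕ → ℕ → OnePoint ℂ) : Prop :=
  ∀ n m k l : ℕ, AdjacentCells n m k l →
    Disjoint (interior (cell g n m)) (interior (cell g k l))

/-- A map to the plane as a map to the sphere. -/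
def toSphere (f : ℕ → ℕ → ℂ) : ℕ → ℕ → OnePoint ℂ := fun n m => (f n m : OnePoint ℂ)

/-- Neighboring points of the lattice. -/
def Neighbors (n m k l : ℕ) : Prop :=
  (l = m ∧ (k = n + 1 ∨ n = k + 1)) ∨ (k = n ∧ (l = m + 1 ∨ m = l + 1))

/-- The images of all neighbors of `(n, m)` lie on the circle of radius `r` with center at the
(finite) point `g n m`. -/
def HasRadius (g : ℕ → ℕ → OnePoint ℂ) (n m : ℕ) (r : ℝ) : Prop :=
  ∃ c : ℂ, g n m = (c : OnePoint ℂ) ∧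
    ∀ k l : ℕ, Neighbors n m k l → ∃ w : ℂ, g k l = (w : OnePoint ℂ) ∧ dist w c = r

end DiscreteConformal

/-! ### The initial radius and the Wallis product. -/

namespace DiscreteConformal
open Filter Topology

/-! Both maps come from one orthogonal circle pattern (`Pattern`): radii R at the vertices with n +
m even (centers) and unit directions e at the vertices with n + m odd (intersection points). For Z²
the edges leaving an intersection point to the right and upwards are e R and i e R, with R the
radius at the other end; for Log they are R⁻¹/e and i R⁻¹/e. At an intersection point, constraint
(3) for Log says exactly that e = n/(R_right + R_left) + i m/(R_up + R_down), which is `hor` and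
`ver`; with these, constraint (2) gives an explicit formula for the value of Z² there. The closing
conditions `ne` and `se` of the kites are invariant under (R, e) ↦ (1/R, 1/e), which is the duality.
The extra relation `diag` makes both constraints hold at the centers as well (`z2_center`,
`log_center`).

The pattern is built diagonal by diagonal below the main diagonal and reflected to the other side.
Away from the main diagonal the evolution is explicit, and `center_step` shows that it preserves the
relations and the positivity of the radii. On the main diagonal one parameter τ = R(2,0)/R(1,1) is
free, and for a wrong τ the directions leave the first quadrant. The two ways of leaving define
disjoint nonempty open sets of parameters, so by connectedness of (1, ∞) some τ avoids both
(`exists_diagGood`). Positivity in the row m = 1 then forces R(1,1) = 2/π by the Wallis product, in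
agreement with the prescribed initial data.

Uniqueness: the constraint determines the axes and the cross-ratio equation the rest. Each of these
equations is linear in the new value, with a coefficient that cannot vanish because the constructed
solution is finite and its neighboring values differ.

Immersion: adjacent cells share a vertex. Around an intersection point the cells lie in four
quadrants; around a center they lie in cones in cyclic order, since the angles of kites are less
than π. The cell at the origin is separate: for Z² it is a segment, for Log a half-strip in Re ≤ 0,
while all other values of Log have Re ≥ 0. -/

/-- A positive sequence with `ρ k < k + 1` and `ρ k * ρ (k + 1) = (k + 1) ^ 2` starts with `2 / π`,
by the Wallis product. -/
theorem wallis_initial_value (ρ : ℕ → ℝ) (pos : ∀ k, 0 < ρ k) (lt : ∀ k, ρ k < k + 1)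
    (mul : ∀ k : ℕ, ρ k * ρ (k + 1) = ((k : ℝ) + 1) ^ 2) : ρ 0 = 2 / Real.pi := by
  have step : ∀ k : ℕ, ρ (k + 2) * ((k : ℝ) + 1) ^ 2 = ((k : ℝ) + 2) ^ 2 * ρ k := by
    intro k
    have h1 := mul k
    have h2 := mul (k + 1)
    push_cast at h2
    have h3 := pos (k + 1)
    apply mul_left_cancel₀ h3.ne'
    linear_combination ((k : ℝ) + 1) ^ 2 * h2 - ((k : ℝ) + 2) ^ 2 * h1
  -- The two-step recursion is that of (2j + 1) times the Wallis partial product.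
  have formula : ∀ j : ℕ, ρ (2 * j) = ρ 0 * ((2 * j + 1) * Real.Wallis.W j) := by
    intro j
    induction j with
    | zero => simp [Real.Wallis.W]
    | succ j ih =>
      have h := step (2 * j)
      rw [ih] at h
      rw [Real.Wallis.W_succ]
      push_cast at h ⊢
      have h1 : (2 * (j : ℝ) + 1) ≠ 0 := by positivity
      have h2 : (2 * (j : ℝ) + 3) ≠ 0 := by positivity
      rw [show 2 * (j + 1) = 2 * j + 2 by ring]
      have h3 : (2 * (j : ℝ) + 1) ^ 2 ≠ 0 := by positivity
      apply mul_right_cancel₀ h3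
      rw [h]
      field_simp
      ring
  -- The upper bound at k is a lower bound at k + 1; so ρ₀ W_j is trapped between 2j/(2j + 1) and 1.
  have gt : ∀ k : ℕ, (k : ℝ) < ρ k := by
    intro k
    cases k with
    | zero => simpa using pos 0
    | succ k =>
      have h1 := mul k
      have h2 := lt k
      have h3 := pos k
      push_cast
      by_contra hc
      push Not at hc
      have : ρ k * ρ (k + 1) < ((k : ℝ) + 1) ^ 2 := by
        have h4 : ρ k * ρ (k + 1) ≤ ρ k * (k + 1) := by gcongr
        have h5 : ρ k * ((k : ℝ) + 1) < (k + 1) * (k + 1) := by gcongr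
        nlinarith
      linarith
  have upper : ∀ j : ℕ, ρ 0 * Real.Wallis.W j ≤ 1 := by
    intro j
    have h := lt (2 * j)
    rw [formula] at h
    push_cast at h
    have h1 : (0 : ℝ) < 2 * j + 1 := by positivity
    by_contra hc
    push Not at hc
    nlinarith
  have lower : ∀ j : ℕ, 1 - 1 / ((j : ℝ) + 1) ≤ ρ 0 * Real.Wallis.W j := by
    intro j
    have h := gt (2 * j)
    rw [formula] at h
    push_cast at h
    have h1 : (0 : ℝ) < 2 * j + 1 := by positivity
    have h2 : (2 * (j : ℝ)) / (2 * j + 1) ≤ ρ 0 * Real.Wallis.W j := by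
      rw [div_le_iff₀ h1]; nlinarith
    refine le_trans ?_ h2
    have h3 : (0 : ℝ) < j + 1 := by positivity
    rw [le_div_iff₀ h1, sub_mul, div_mul_eq_mul_div, sub_le_iff_le_add]
    have : 1 ≤ 1 * (2 * (j : ℝ) + 1) / (j + 1) := by
      rw [le_div_iff₀ h3]; linarith
    linarith
  have lim1 : Tendsto (fun j => ρ 0 * Real.Wallis.W j) atTop (𝓝 (ρ 0 * (Real.pi / 2))) :=
    Real.Wallis.tendsto_W_nhds_pi_div_two.const_mul _
  have lim2 : Tendsto (fun j : ℕ => 1 - 1 / ((j : ℝ) + 1)) atTop (𝓝 1) := by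
    simpa using (tendsto_one_div_add_atTop_nhds_zero_nat (𝕜 := ℝ)).const_sub 1
  have h1 := le_of_tendsto lim1 (Eventually.of_forall upper)
  have h2 := le_of_tendsto_of_tendsto lim2 lim1 (Eventually.of_forall lower)
  have h3 : ρ 0 * (Real.pi / 2) = 1 := le_antisymm h1 h2
  have hp := Real.pi_pos
  field_simp
  linarith

/-! ### Shooting along the main diagonal. -/

/-- The next quotient `T` in the recursion along the diagonal. -/
noncomputable def nextQuot (k X Y T : ℝ) : ℝ := (X * Y + (k + 1) * T * Y ^ 2) / (k * X ^ 2)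

/-- First coordinate of `(X + i Y) (1 + i T) / (T + i)`. -/
noncomputable def rotFst (T X Y : ℝ) : ℝ := (2 * T * X - (T ^ 2 - 1) * Y) / (T ^ 2 + 1)

/-- Second coordinate of `(X + i Y) (1 + i T) / (T + i)`. -/
noncomputable def rotSnd (T X Y : ℝ) : ℝ := (2 * T * Y + (T ^ 2 - 1) * X) / (T ^ 2 + 1)

theorem rot_sq_add_sq (T X Y : ℝ) : rotFst T X Y ^ 2 + rotSnd T X Y ^ 2 = X ^ 2 + Y ^ 2 := by
  have : T ^ 2 + 1 ≠ 0 := by positivity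
  unfold rotFst rotSnd
  field_simp
  ring

/-- With X' + iY' the rotated direction, this and `rot_sub` are the imaginary and the real part of
(X' + iY')(T + i) = (X + iY)(1 + iT). -/
theorem rot_add (T X Y : ℝ) : rotFst T X Y + T * rotSnd T X Y = T * X + Y := by
  have : T ^ 2 + 1 ≠ 0 := by positivity
  unfold rotFst rotSnd
  field_simp
  ring

theorem rot_sub (T X Y : ℝ) : T * rotFst T X Y - rotSnd T X Y = X - T * Y := by
  have : T ^ 2 + 1 ≠ 0 := by positivity
  unfold rotFst rotSnd
  field_simp
  ring

/-- The directions and quotients along the diagonal of the quadrant, as functions of the initial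
quotient; the entry with index `i` belongs to the vertex `(i + 2, i + 1)`. -/
noncomputable def diagSeq (τ : ℝ) : ℕ → ℝ × ℝ × ℝ
  | 0 => (rotFst τ 1 0, rotSnd τ 1 0, τ)
  | i + 1 =>
    let s := diagSeq τ i
    let T := nextQuot (i + 1) s.1 s.2.1 s.2.2
    (rotFst T s.1 s.2.1, rotSnd T s.1 s.2.1, T)

/-- The entry with index `i` has its direction in the open first quadrant. -/
def DiagGood (τ : ℝ) (i : ℕ) : Prop := 0 < (diagSeq τ i).1 ∧ 0 < (diagSeq τ i).2.1

theorem diagSeq_unit (τ : ℝ) (i : ℕ) : (diagSeq τ i).1 ^ 2 + (diagSeq τ i).2.1 ^ 2 = 1 := by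
  induction i with
  | zero => simp [diagSeq, rot_sq_add_sq]
  | succ i ih => simp only [diagSeq, rot_sq_add_sq, ih]

theorem diagSeq_quot_pos {τ : ℝ} (hτ : 0 < τ) {i : ℕ} (h : ∀ l < i, DiagGood τ l) :
    0 < (diagSeq τ i).2.2 := by
  induction i with
  | zero => simpa [diagSeq] using hτ
  | succ i ih =>
    have h1 := ih fun l hl => h l (by omega)
    obtain ⟨h2, h3⟩ := h i (by omega)
    simp only [diagSeq, nextQuot]
    positivity

/-- By `rot_add`, X' + T Y' = T X + Y > 0. Hence a first exit from the quadrant happens through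
exactly one of its two sides. -/
theorem diagSeq_not_both_nonpos {τ : ℝ} (hτ : 0 < τ) {i : ℕ} (h : ∀ l ≤ i, DiagGood τ l) :
    0 < (diagSeq τ (i + 1)).1 ∨ 0 < (diagSeq τ (i + 1)).2.1 := by
  have hT := diagSeq_quot_pos hτ (i := i + 1) fun l hl => h l (by omega)
  obtain ⟨h2, h3⟩ := h i le_rfl
  have key := rot_add (diagSeq τ (i + 1)).2.2 (diagSeq τ i).1 (diagSeq τ i).2.1
  have e1 : rotFst (diagSeq τ (i + 1)).2.2 (diagSeq τ i).1 (diagSeq τ i).2.1 =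
    (diagSeq τ (i + 1)).1 := rfl
  have e2 : rotSnd (diagSeq τ (i + 1)).2.2 (diagSeq τ i).1 (diagSeq τ i).2.1 =
    (diagSeq τ (i + 1)).2.1 := rfl
  rw [e1, e2] at key
  by_contra! hc
  have := mul_pos hT h2
  nlinarith [mul_nonneg hT.le (neg_nonneg.2 hc.2)]

/-- By `rot_sub`, T X' = Y' + X - T Y, and both X and Y' are at most 1. The bound on T near the
first axis is needed in `diagSeq_exit_snd`. -/
theorem diagSeq_quot_le {τ : ℝ} (hτ : 1 < τ) {i : ℕ} (h : ∀ l ≤ i, DiagGood τ l) :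
    (diagSeq τ i).2.2 * (diagSeq τ i).1 ≤ 2 := by
  have hT := diagSeq_quot_pos (by linarith : 0 < τ) (i := i) fun l hl => h l (by omega)
  obtain ⟨h2, h3⟩ := h i le_rfl
  have hu := diagSeq_unit τ i
  have hY : (diagSeq τ i).2.1 ≤ 1 := by nlinarith
  cases i with
  | zero =>
    have key := rot_sub τ 1 0
    have e1 : rotFst τ 1 0 = (diagSeq τ 0).1 := rfl
    have e2 : rotSnd τ 1 0 = (diagSeq τ 0).2.1 := rfl
    have e3 : (diagSeq τ 0).2.2 = τ := rfl
    rw [e1, e2] at key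
    rw [e3]
    linarith
  | succ i =>
    obtain ⟨h4, h5⟩ := h i (by omega)
    have hu' := diagSeq_unit τ i
    have hX : (diagSeq τ i).1 ≤ 1 := by nlinarith
    have key := rot_sub (diagSeq τ (i + 1)).2.2 (diagSeq τ i).1 (diagSeq τ i).2.1
    have e1 : rotFst (diagSeq τ (i + 1)).2.2 (diagSeq τ i).1 (diagSeq τ i).2.1 =
      (diagSeq τ (i + 1)).1 := rfl
    have e2 : rotSnd (diagSeq τ (i + 1)).2.2 (diagSeq τ i).1 (diagSeq τ i).2.1 =
      (diagSeq τ (i + 1)).2.1 := rfl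
    rw [e1, e2] at key
    have := mul_pos hT h5
    linarith

/-- A direction close to the second axis leaves the first quadrant in the next step. -/
theorem diagSeq_exit_fst {τ : ℝ} (hτ : 1 < τ) {i : ℕ} (h : ∀ l ≤ i, DiagGood τ l)
    (hX : (diagSeq τ i).1 < 1 / (4 * (i + 1))) : (diagSeq τ (i + 1)).1 < 0 := by
  have hT := diagSeq_quot_pos (by linarith : 0 < τ) (i := i) fun l hl => h l (by omega)
  obtain ⟨h2, h3⟩ := h i le_rfl
  have hu := diagSeq_unit τ i
  simp only [diagSeq]
  generalize (diagSeq τ i).1 = X at *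
  generalize (diagSeq τ i).2.1 = Y at *
  generalize (diagSeq τ i).2.2 = T at *
  have hk : (1 : ℝ) ≤ i + 1 := by simp
  generalize (i : ℝ) + 1 = k at *
  have hkX : k * X < 1 / 4 := by
    rw [lt_div_iff₀ (by positivity)] at hX; linarith
  have hX4 : X < 1 / 4 := by nlinarith
  have hY : 9 / 10 < Y := by nlinarith
  have hY1 : Y ≤ 1 := by nlinarith
  -- Y/(kX) is the first summand of the new quotient and exceeds 3 since kX < 1/4; a large quotient
  -- turns the direction past the second axis.
  have hT' : 3 < nextQuot k X Y T := by
    have : 3 < Y / (k * X) := by rw [lt_div_iff₀ (by positivity)]; linarith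
    refine this.trans_le ?_
    unfold nextQuot
    rw [div_le_div_iff₀ (by positivity) (by positivity)]
    have : 0 ≤ (k + 1) * T * Y ^ 2 * (k * X) := by positivity
    nlinarith
  generalize nextQuot k X Y T = S at *
  unfold rotFst
  apply div_neg_of_neg_of_pos _ (by positivity)
  have h4 : 0 < S * Y - 2 * X - 2 := by nlinarith
  nlinarith [mul_pos (by linarith : 0 < S) h4]

/-- A direction close to the first axis leaves the first quadrant in the next step. -/
theorem diagSeq_exit_snd {τ : ℝ} (hτ : 1 < τ) {i : ℕ} (h : ∀ l ≤ i, DiagGood τ l)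
    (hY : (diagSeq τ i).2.1 < 1 / 8) : (diagSeq τ (i + 1)).2.1 < 0 := by
  have hT := diagSeq_quot_pos (by linarith : 0 < τ) (i := i) fun l hl => h l (by omega)
  have hT2 := diagSeq_quot_le hτ h
  obtain ⟨h2, h3⟩ := h i le_rfl
  have hu := diagSeq_unit τ i
  simp only [diagSeq]
  generalize (diagSeq τ i).1 = X at *
  generalize (diagSeq τ i).2.1 = Y at *
  generalize (diagSeq τ i).2.2 = T at *
  have hk : (1 : ℝ) ≤ i + 1 := by simp
  generalize (i : ℝ) + 1 = k at *
  have hX : 98 / 100 < X := by nlinarith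
  have hT3 : T < 21 / 10 := by nlinarith
  have hX1 : X ≤ 1 := by nlinarith
  have hS0 : 0 < nextQuot k X Y T := by unfold nextQuot; positivity
  -- Every summand of the new quotient contains the small factor Y; a small quotient turns the
  -- direction past the first axis.
  have hS : nextQuot k X Y T < 1 / 4 := by
    unfold nextQuot
    rw [div_lt_iff₀ (by positivity)]
    have h1 : X * Y ≤ 1 / 8 * k := by nlinarith
    have h2 : (k + 1) * T * Y ^ 2 ≤ (2 * k) * (21 / 10) * (1 / 8) ^ 2 := by gcongr; linarith
    have h3 : k * (98 / 100) ^ 2 ≤ k * X ^ 2 := by gcongr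
    nlinarith
  generalize nextQuot k X Y T = S at *
  unfold rotSnd
  apply div_neg_of_neg_of_pos _ (by positivity)
  nlinarith [mul_pos hS0 h3]

theorem continuousAt_diagSeq {τ : ℝ} {i : ℕ} (h : ∀ l < i, (diagSeq τ l).1 ≠ 0) :
    ContinuousAt (fun τ => diagSeq τ i) τ := by
  have rotc : ∀ {a b c : ℝ → ℝ}, ContinuousAt a τ → ContinuousAt b τ → ContinuousAt c τ →
      ContinuousAt (fun t => (rotFst (a t) (b t) (c t), rotSnd (a t) (b t) (c t), a t)) τ := by
    intro a b c ha hb hc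
    unfold rotFst rotSnd
    have : a τ ^ 2 + 1 ≠ 0 := by positivity
    refine ContinuousAt.prodMk ?_ (ContinuousAt.prodMk ?_ ha)
    · exact ContinuousAt.div (by fun_prop) (by fun_prop) this
    · exact ContinuousAt.div (by fun_prop) (by fun_prop) this
  induction i with
  | zero => exact rotc continuousAt_id continuousAt_const continuousAt_const
  | succ i ih =>
    have h1 := ih fun l hl => h l (by omega)
    have hx : ContinuousAt (fun t => (diagSeq t i).1) τ := h1.fst
    have hy : ContinuousAt (fun t => (diagSeq t i).2.1) τ := h1.snd.fst
    have hz : ContinuousAt (fun t => (diagSeq t i).2.2) τ := h1.snd.snd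
    have h0 := h i (by omega)
    refine rotc (a := fun t => nextQuot (i + 1) (diagSeq t i).1 (diagSeq t i).2.1 (diagSeq t i).2.2)
      ?_ hx hy
    unfold nextQuot
    refine ContinuousAt.div (by fun_prop) (by fun_prop) ?_
    exact mul_ne_zero (Nat.cast_add_one_ne_zero i) (pow_ne_zero 2 h0)

/-- There is an initial quotient for which all directions along the diagonal stay in the open first
quadrant. -/
theorem exists_diagGood : ∃ τ : ℝ, 1 < τ ∧ ∀ i, DiagGood τ i := by
  by_contra! hno
  -- The thresholds are slightly inside the quadrant, so that the sets are defined by strict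
  -- inequalities, hence open, yet contain all actual exits. They are those of the two exit lemmas;
  -- the first depends on the index because the leading term of the new quotient is Y/(kX).
  let low : Set ℝ := {τ | 1 < τ ∧ ∃ i : ℕ, (∀ l ≤ i, DiagGood τ l) ∧
    0 < (diagSeq τ (i + 1)).2.1 ∧ (diagSeq τ (i + 1)).1 < 1 / (4 * ((i + 1 : ℕ) + 1))}
  let high : Set ℝ := {τ | 1 < τ ∧ ∃ i : ℕ, (∀ l ≤ i, DiagGood τ l) ∧
    0 < (diagSeq τ (i + 1)).1 ∧ (diagSeq τ (i + 1)).2.1 < 1 / 8}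
  have evGood : ∀ {τ : ℝ} {i : ℕ}, (∀ l ≤ i, DiagGood τ l) →
      ∀ᶠ t in 𝓝 τ, ∀ l ≤ i, DiagGood t l := by
    intro τ i h
    have : ∀ l ∈ Finset.range (i + 1), ∀ᶠ t in 𝓝 τ, DiagGood t l := by
      intro l hl
      have hl := Finset.mem_range.1 hl
      have hc := continuousAt_diagSeq (τ := τ) (i := l) fun l' hl' => (h l' (by omega)).1.ne'
      exact (hc.fst.eventually (lt_mem_nhds (h l (by omega)).1)).and
        (hc.snd.fst.eventually (lt_mem_nhds (h l (by omega)).2))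
    filter_upwards [(Finset.eventually_all _).2 this] with t ht l hl
    exact ht l (Finset.mem_range.2 (by omega))
  have openLow : IsOpen low := by
    rw [isOpen_iff_mem_nhds]
    rintro τ ⟨h1, i, hg, hy, hx⟩
    have hc := continuousAt_diagSeq (τ := τ) (i := i + 1) fun l hl => (hg l (by omega)).1.ne'
    filter_upwards [lt_mem_nhds h1, evGood hg, hc.snd.fst.eventually (lt_mem_nhds hy),
      hc.fst.eventually (gt_mem_nhds hx)] with t a b c d
    exact ⟨a, i, b, c, d⟩
  have openHigh : IsOpen high := by
    rw [isOpen_iff_mem_nhds]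
    rintro τ ⟨h1, i, hg, hx, hy⟩
    have hc := continuousAt_diagSeq (τ := τ) (i := i + 1) fun l hl => (hg l (by omega)).1.ne'
    filter_upwards [lt_mem_nhds h1, evGood hg, hc.fst.eventually (lt_mem_nhds hx),
      hc.snd.fst.eventually (gt_mem_nhds hy)] with t a b c d
    exact ⟨a, i, b, c, d⟩
  have good0 : ∀ {τ : ℝ}, 1 < τ → DiagGood τ 0 := by
    intro τ hτ
    constructor
    · simp only [diagSeq, rotFst]
      exact div_pos (by nlinarith) (by positivity)
    · simp only [diagSeq, rotSnd]
      exact div_pos (by nlinarith) (by positivity)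
  have cover : Set.Ioi (1 : ℝ) ⊆ low ∪ high := by
    intro τ hτ
    classical
    have hex := hno τ hτ
    have hspec := Nat.find_spec hex
    have hmin := fun l => Nat.find_min hex (m := l)
    rcases hn : Nat.find hex with _ | i
    · rw [hn] at hspec; exact absurd (good0 hτ) hspec
    · rw [hn] at hspec hmin
      have hg : ∀ l ≤ i, DiagGood τ l := fun l hl => not_not.1 (hmin l (by omega))
      rcases le_or_gt (diagSeq τ (i + 1)).1 0 with h | h
      · left
        have := (diagSeq_not_both_nonpos (by linarith [Set.mem_Ioi.1 hτ]) hg).resolve_left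
          (not_lt.2 h)
        exact ⟨hτ, i, hg, this, h.trans_lt (by positivity)⟩
      · right
        refine ⟨hτ, i, hg, h, ?_⟩
        by_contra hc
        exact hspec ⟨h, by linarith⟩
  -- A near-exit on one side is followed by a real exit on the same side, which rules out a later
  -- near-exit on the other side. At equal indices the unit length of the direction is contradicted.
  have disj : ∀ τ, τ ∈ low → τ ∈ high → False := by
    rintro τ ⟨hτ, i, hgi, hiY, hiX⟩ ⟨-, j, hgj, hjX, hjY⟩
    rcases lt_trichotomy i j with hij | rfl | hij
    · have hex := diagSeq_exit_fst hτ (fun l hl => hgj l (by omega)) hiX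
      rcases Nat.lt_or_ge (i + 1) j with h' | h'
      · exact absurd (hgj (i + 1 + 1) (by omega)).1 (by linarith)
      · obtain rfl : j = i + 1 := by omega
        linarith
    · have hu := diagSeq_unit τ (i + 1)
      have : 1 / (4 * (((i + 1 : ℕ) : ℝ) + 1)) ≤ 1 / 4 := by
        apply one_div_le_one_div_of_le (by norm_num)
        have : (0 : ℝ) ≤ ((i + 1 : ℕ) : ℝ) := by positivity
        linarith
      nlinarith
    · have hex := diagSeq_exit_snd hτ (fun l hl => hgi l (by omega)) hjY
      rcases Nat.lt_or_ge (j + 1) i with h' | h'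
      · exact absurd (hgi (j + 1 + 1) (by omega)).2 (by linarith)
      · obtain rfl : i = j + 1 := by omega
        linarith
  -- The samples 10 and 11/10 lie on either side of π/2, the value of τ that belongs to R(1,1) = 2/π
  -- and R(2,0) = 1.
  have neLow : (Set.Ioi (1 : ℝ) ∩ low).Nonempty := by
    refine ⟨10, by norm_num [Set.mem_Ioi], by norm_num, 0, ?_, ?_, ?_⟩
    · intro l hl
      obtain rfl : l = 0 := by omega
      exact good0 (by norm_num)
    · norm_num [diagSeq, rotFst, rotSnd, nextQuot]
    · norm_num [diagSeq, rotFst, rotSnd, nextQuot]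
  have neHigh : (Set.Ioi (1 : ℝ) ∩ high).Nonempty := by
    refine ⟨11 / 10, by norm_num [Set.mem_Ioi], by norm_num, 0, ?_, ?_, ?_⟩
    · intro l hl
      obtain rfl : l = 0 := by omega
      exact good0 (by norm_num)
    · norm_num [diagSeq, rotFst, rotSnd, nextQuot]
    · norm_num [diagSeq, rotFst, rotSnd, nextQuot]
  obtain ⟨τ, -, h1, h2⟩ := isPreconnected_Ioi low high openLow openHigh cover neLow neHigh
  exact disj τ h1 h2

end DiscreteConformal

/-! ### Propagation of the pattern from diagonal to diagonal. -/

namespace DiscreteConformal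

theorem mul_add_I_eq_iff (z w : ℂ) (a b c d : ℝ) :
    z * (a + b * Complex.I) = w * (c + d * Complex.I) ↔
      z.re * a - z.im * b = w.re * c - w.im * d ∧ z.re * b + z.im * a = w.re * d + w.im * c := by
  simp [Complex.ext_iff]

theorem add_I_ne_zero {a b : ℝ} (h : 0 < a ∨ 0 < b) : (a + b * Complex.I : ℂ) ≠ 0 := by
  intro hc
  have h1 := congrArg Complex.re hc
  have h2 := congrArg Complex.im hc
  simp at h1 h2
  rcases h with h | h <;> linarith

/-- The local step of the evolution of a circle pattern across a circle of radius `q`. The centers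
of three neighboring circles, of radii `u`, `p`, `s`, and the directions `E`, `E'`, `F`, `F'` at
the four points of the circle are given; the radius of the fourth neighboring circle is
`N / F.re - p`. -/
theorem center_step {E E' F F' : ℂ} {q u p s N M : ℝ} (hq : 0 < q) (hu : 0 < u) (hp : 0 < p)
    (hs : 0 < s) (hX' : 0 < E'.re) (hY : 0 < E.im) (hF : 0 < F.re)
    (hEE' : E' * (q + u * Complex.I) = E * (u + q * Complex.I))
    (hEF : F * (p + q * Complex.I) = E * (q + p * Complex.I))
    (hE'F' : F' * (q + s * Complex.I) = E' * (s + q * Complex.I))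
    (hM : E.im * (u + p) = M) (hN : E'.re * (s + u) = N)
    (hK : q * E.re + u * E.im = (N + M) / 2) :
    0 < N / F.re - p ∧
    F' * ((N / F.re - p : ℝ) + q * Complex.I) = F * (q + (N / F.re - p : ℝ) * Complex.I) ∧
    F'.im * (s + (N / F.re - p)) = M := by
  obtain ⟨n1, n2⟩ := (mul_add_I_eq_iff _ _ _ _ _ _).1 hEE'
  obtain ⟨f1, f2⟩ := (mul_add_I_eq_iff _ _ _ _ _ _).1 hEF
  obtain ⟨g1, g2⟩ := (mul_add_I_eq_iff _ _ _ _ _ _).1 hE'F'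
  have dX' : E'.re * (q ^ 2 + u ^ 2) = 2 * u * q * E.re - (q ^ 2 - u ^ 2) * E.im := by
    linear_combination q * n1 + u * n2
  have dK' : q * E'.im + u * E'.re = (N + M) / 2 := by linear_combination hK + n2
  have dF : F.re * (q ^ 2 + p ^ 2) = 2 * q * p * E.re - (p ^ 2 - q ^ 2) * E.im := by
    linear_combination p * f1 + q * f2
  have dF' : F'.im * (q ^ 2 + s ^ 2) = 2 * s * q * E'.im + (q ^ 2 - s ^ 2) * E'.re := by
    linear_combination q * g2 - s * g1
  -- As E'.re and E.im are positive, q² - su and q² - pu have opposite signs or both vanish. This is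
  -- the source of positivity for both the denominator S and the numerator of the new radius.
  have two : E'.re * (q ^ 2 - s * u) + E.im * (q ^ 2 - p * u) = 0 := by
    linear_combination dX' + 2 * u * hK - u * hM - u * hN
  set S := u * p + p * s + s * u - q ^ 2 with hS
  have S_pos : 0 < S := by
    rcases le_or_gt (q ^ 2) (s * u) with h | h
    · have := mul_pos hu hp
      have := mul_pos hp hs
      linarith
    · have h1 : 0 < E'.re * (q ^ 2 - s * u) := mul_pos hX' (by linarith)
      have h2 : E.im * (q ^ 2 - p * u) < 0 := by linarith
      have h3 : q ^ 2 - p * u < 0 := by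
        by_contra hc
        exact absurd (mul_nonneg hY.le (not_lt.1 hc)) (by linarith)
      have := mul_pos hs hu
      have := mul_pos hp hs
      linarith
  have num_pos : 0 < q ^ 2 * (u + p + s) - u * p * s := by
    have hq2 : 0 < q ^ 2 := by positivity
    rcases le_or_gt (s * u) (q ^ 2) with h | h
    · nlinarith [mul_nonneg (sub_nonneg.2 h) hp.le, mul_pos hq2 hu, mul_pos hq2 hs]
    · have h1 : E'.re * (q ^ 2 - s * u) < 0 := mul_neg_of_pos_of_neg hX' (by linarith)
      have h3 : 0 < q ^ 2 - p * u := by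
        by_contra hc
        exact absurd (mul_nonneg hY.le (neg_nonneg.2 (not_lt.1 hc))) (by linarith)
      nlinarith [mul_pos h3 hs, mul_pos hq2 hu, mul_pos hq2 hp]
  have hFS : F.re * (q ^ 2 + p ^ 2) = E'.re * S := by
    rw [hS]
    linear_combination dF + two + 2 * p * hK - p * hN - p * hM
  have hF'S : F'.im * (q ^ 2 + s ^ 2) = E.im * S := by
    rw [hS]
    linear_combination dF' + two + 2 * s * dK' - s * hN - s * hM
  -- The fraction is the radius for which the four kite angles 2 arctan(·/q) at the center add up to
  -- 2π.
  have hv : N / F.re - p = (q ^ 2 * (u + p + s) - u * p * s) / S := by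
    rw [sub_eq_iff_eq_add, div_eq_iff hF.ne', div_add' _ _ _ S_pos.ne', div_mul_eq_mul_div,
      eq_div_iff S_pos.ne', ← hN]
    rw [hS] at hFS ⊢
    linear_combination -(s + u) * hFS
  set v := N / F.re - p
  have hvS : v * S = q ^ 2 * (u + p + s) - u * p * s := by
    rw [hv]; field_simp
  refine ⟨by rw [hv]; positivity, ?_, ?_⟩
  · have c1 := add_I_ne_zero (a := q) (b := s) (.inl hq)
    have c2 := add_I_ne_zero (a := q) (b := u) (.inl hq)
    have c3 := add_I_ne_zero (a := p) (b := q) (.inl hp)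
    have hvS' : (v : ℂ) * (u * p + p * s + s * u - q ^ 2) = q ^ 2 * (u + p + s) - u * p * s := by
      rw [hS] at hvS
      exact_mod_cast hvS
    apply mul_right_cancel₀ (mul_ne_zero (mul_ne_zero c1 c2) c3)
    have hI : Complex.I ^ 2 = -1 := Complex.I_sq
    -- Equivalent to the reality of the product of q + ri over the four neighboring radii r, because
    -- r + qi = i(q - ri).
    have schramm : (u + q * Complex.I) * (s + q * Complex.I) * (v + q * Complex.I) *
        (p + q * Complex.I) = (q + p * Complex.I) * (q + v * Complex.I) * (q + s * Complex.I) *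
        ((q : ℂ) + u * Complex.I) := by
      have hI3 : Complex.I ^ 3 = -Complex.I := by rw [pow_succ, hI]; ring
      have hI4 : Complex.I ^ 4 = 1 := by
        rw [show Complex.I ^ 4 = (Complex.I ^ 2) ^ 2 by ring, hI]; ring
      ring_nf
      simp only [hI, hI3, hI4]
      linear_combination 2 * Complex.I * q * hvS'
    calc _ = (F' * (q + s * Complex.I)) * (q + u * Complex.I) * (p + q * Complex.I) *
          (v + q * Complex.I) := by ring
      _ = (E' * (q + u * Complex.I)) * (s + q * Complex.I) * (p + q * Complex.I) *
          (v + q * Complex.I) := by rw [hE'F']; ring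
      _ = E * ((u + q * Complex.I) * (s + q * Complex.I) * (v + q * Complex.I) *
          (p + q * Complex.I)) := by rw [hEE']; ring
      _ = (E * (q + p * Complex.I)) * (q + v * Complex.I) * (q + s * Complex.I) *
          (q + u * Complex.I) := by rw [schramm]; ring
      _ = _ := by rw [← hEF]; ring
  · have h1 : 0 < q ^ 2 + s ^ 2 := by positivity
    apply mul_right_cancel₀ (mul_ne_zero h1.ne' S_pos.ne')
    have : (s + v) * S = (q ^ 2 + s ^ 2) * (u + p) := by
      rw [add_mul, hvS, hS]; ring
    calc _ = (F'.im * (q ^ 2 + s ^ 2)) * ((s + v) * S) := by ring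
      _ = _ := by rw [hF'S, this, ← hM]; ring

/-- Two neighboring diagonals of a circle pattern: `A m` and `B m` are the radii of the circles at
`(m + 2 j, m)` and `(m + 2 j + 2, m)`, and `e m` is the direction at the intersection point
`(m + 2 j + 1, m)`. -/
structure Level (j : ℕ) (A B : ℕ → ℝ) (e : ℕ → ℂ) : Prop where
  A_pos : ∀ m, 0 < A (m + 1)
  B_pos : ∀ m, 0 < B m
  re_pos : ∀ m, 0 < (e m).re
  im_zero : (e 0).im = 0
  unit : ∀ m, (e m).re ^ 2 + (e m).im ^ 2 = 1
  hor : ∀ m : ℕ, (e m).re * (B m + A m) = m + 2 * j + 1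
  ver : ∀ m : ℕ, (e (m + 1)).im * (A (m + 2) + B m) = m + 1
  diag : ∀ m : ℕ, B m * (e m).re + A (m + 1) * (e m).im = m + j + 1
  ne : ∀ m, e (m + 1) * (B m + A (m + 1) * Complex.I) = e m * (A (m + 1) + B m * Complex.I)

theorem Level.im_pos {j : ℕ} {A B : ℕ → ℝ} {e : ℕ → ℂ} (h : Level j A B e) (m : ℕ) :
    0 < (e (m + 1)).im := by
  have h1 := h.A_pos (m + 1)
  have h2 := h.B_pos m
  have h3 := h.ver m
  by_contra hc
  have : (e (m + 1)).im * (A (m + 2) + B m) ≤ 0 :=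
    mul_nonpos_of_nonpos_of_nonneg (not_lt.1 hc) (by linarith)
  have : (0 : ℝ) < m + 1 := by positivity
  linarith

/-- The directions on the next diagonal. -/
noncomputable def nextDir (B : ℕ → ℝ) (e : ℕ → ℂ) (m : ℕ) : ℂ :=
  e (m + 1) * (B (m + 1) + B m * Complex.I) / (B m + B (m + 1) * Complex.I)

/-- The radii on the next diagonal. -/
noncomputable def nextRadius (j : ℕ) (B : ℕ → ℝ) (e : ℕ → ℂ) (m : ℕ) : ℝ :=
  ((m : ℝ) + 2 * j + 3) / (nextDir B e m).re - B m

/-- The new direction is forced by closing the kite, the new radius by `hor`. All that could fail is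
positivity of the real parts and radii and the relations at the new points; `center_step` handles
the radii, `ver` and `ne`. -/
theorem Level.next {j : ℕ} {A B : ℕ → ℝ} {e : ℕ → ℂ} (h : Level j A B e) :
    Level (j + 1) B (nextRadius j B e) (nextDir B e) := by
  have se : ∀ m, nextDir B e m * (B m + B (m + 1) * Complex.I) =
      e (m + 1) * (B (m + 1) + B m * Complex.I) := fun m =>
    div_mul_cancel₀ _ (add_I_ne_zero (.inl (h.B_pos m)))
  -- The difference of `diag` and `ver`; it makes the real part of the new direction a sum of
  -- positive terms.
  have g : ∀ m, B (m + 1) * (e (m + 1)).re - B m * (e (m + 1)).im = j + 1 := by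
    intro m
    have h1 := h.diag (m + 1)
    have h2 := h.ver m
    push_cast at h1
    linear_combination h1 - h2
  have re_pos : ∀ m, 0 < (nextDir B e m).re := by
    intro m
    obtain ⟨f1, f2⟩ := (mul_add_I_eq_iff _ _ _ _ _ _).1 (se m)
    have hp := h.B_pos m
    have hq := h.B_pos (m + 1)
    have hX := h.re_pos (m + 1)
    have hY := h.im_pos m
    have key : (nextDir B e m).re * (B m ^ 2 + B (m + 1) ^ 2) =
        B m * (j + 1) + B (m + 1) * (B m * (e (m + 1)).re + B (m + 1) * (e (m + 1)).im) := by
      linear_combination B m * f1 + B (m + 1) * f2 + B m * g m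
    have : 0 < (nextDir B e m).re * (B m ^ 2 + B (m + 1) ^ 2) := by rw [key]; positivity
    exact pos_of_mul_pos_left this (by positivity)
  have step := fun m : ℕ => center_step (N := m + 2 * j + 3) (M := m + 1) (h.B_pos (m + 1))
    (h.A_pos (m + 1)) (h.B_pos m) (h.B_pos (m + 2)) (h.re_pos (m + 2)) (h.im_pos m) (re_pos m)
    (h.ne (m + 1)) (se m) (se (m + 1)) (h.ver m)
    (by have := h.hor (m + 2); push_cast at this; linear_combination this)
    (by have := h.diag (m + 1); push_cast at this; linear_combination this)
  have unit : ∀ m, (nextDir B e m).re ^ 2 + (nextDir B e m).im ^ 2 = 1 := by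
    intro m
    obtain ⟨f1, f2⟩ := (mul_add_I_eq_iff _ _ _ _ _ _).1 (se m)
    have hp := h.B_pos m
    have h0 : (0 : ℝ) < B m ^ 2 + B (m + 1) ^ 2 := by positivity
    have hu := h.unit (m + 1)
    apply mul_right_cancel₀ h0.ne'
    have e1 := congrArg (· ^ 2) f1
    have e2 := congrArg (· ^ 2) f2
    linear_combination e1 + e2 + (B m ^ 2 + B (m + 1) ^ 2) * hu
  have hor : ∀ m : ℕ, (nextDir B e m).re * (nextRadius j B e m + B m) = m + 2 * j + 3 := by
    intro m
    unfold nextRadius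
    have := (re_pos m).ne'
    field_simp
    ring
  refine ⟨fun m => h.B_pos _, fun m => (step m).1, re_pos, ?_, unit, fun m => ?_, fun m => ?_,
    fun m => ?_, fun m => (step m).2.1⟩
  -- On the axis: the old axis direction is 1, so `hq` fixes e 1 up to the radii, and turning it
  -- across the next kite gives a real direction again.
  · obtain ⟨f1, f2⟩ := (mul_add_I_eq_iff _ _ _ _ _ _).1 (se 0)
    obtain ⟨n1, n2⟩ := (mul_add_I_eq_iff _ _ _ _ _ _).1 (h.ne 0)
    have hu0 := h.unit 0
    have hu1 := h.unit 1
    have hX0 := h.re_pos 0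
    have hX1 := h.re_pos 1
    have hp := h.B_pos 0
    have hg := h.diag 0
    have g0 := g 0
    rw [h.im_zero] at hu0 hg
    have hX : (e 0).re = 1 := by nlinarith
    rw [hX] at hg
    simp only [zero_add] at *
    push_cast at hg
    have hq : B 1 * (e 1).re = B 0 * (1 + (e 1).im) := by linear_combination g0 - hg
    have h0 : (0 : ℝ) < B 0 ^ 2 + B 1 ^ 2 := by positivity
    have key : B 0 * (e 1).re + B 1 * (e 1).im = B 1 := by
      apply mul_left_cancel₀ hX1.ne'
      linear_combination ((e 1).im - 1) * hq + B 0 * hu1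
    apply mul_right_cancel₀ h0.ne'
    linear_combination B 0 * f2 - B 1 * f1 - B 1 * hq + B 0 * key
  · rw [hor]; push_cast; ring
  · have := (step m).2.2
    unfold nextRadius
    exact this
  · obtain ⟨f1, f2⟩ := (mul_add_I_eq_iff _ _ _ _ _ _).1 (se m)
    have := hor m
    push_cast
    linear_combination this - f1 - g m

end DiscreteConformal

/-! ### The pattern on the whole quadrant. -/

namespace DiscreteConformal

/-- The radii of the circles on the diagonal. -/
noncomputable def diagRadius (τ : ℝ) : ℕ → ℝ
  | 0 => 0
  | i + 1 => ((i : ℝ) + 1) / ((diagSeq τ i).1 + (diagSeq τ i).2.1 * (diagSeq τ i).2.2)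

/-- The directions next to the diagonal. -/
noncomputable def diagDir (τ : ℝ) : ℕ → ℂ
  | 0 => 1
  | i + 1 => ⟨(diagSeq τ i).1, (diagSeq τ i).2.1⟩

/-- The third entry of `diagSeq` is R(m+2,m)/R(m+1,m+1), and `D1` is `ver` with the radii expressed
by these quotients. The radius at index 0 is the vanishing one at the origin. -/
theorem level_zero {τ : ℝ} (hτ : 1 < τ) (h : ∀ i, DiagGood τ i) :
    Level 0 (diagRadius τ) (fun m => diagRadius τ (m + 1) * (diagSeq τ m).2.2) (diagDir τ) := by
  have hT : ∀ i, 0 < (diagSeq τ i).2.2 := fun i =>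
    diagSeq_quot_pos (by linarith) fun l _ => h l
  have hX : ∀ i, 0 < (diagSeq τ i).1 := fun i => (h i).1
  have hY : ∀ i, 0 < (diagSeq τ i).2.1 := fun i => (h i).2
  have pos : ∀ i, 0 < diagRadius τ (i + 1) := fun i => by
    have := hT i; have := hX i; have := hY i
    simp only [diagRadius]; positivity
  have D1 : ∀ i : ℕ, diagRadius τ (i + 1) *
      ((diagSeq τ i).1 + (diagSeq τ i).2.1 * (diagSeq τ i).2.2) = i + 1 := fun i => by
    have := hT i; have := hX i; have := hY i
    simp only [diagRadius]
    exact div_mul_cancel₀ _ (by positivity)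
  have rotA : ∀ i, (diagSeq τ (i + 1)).1 + (diagSeq τ (i + 1)).2.2 * (diagSeq τ (i + 1)).2.1 =
      (diagSeq τ (i + 1)).2.2 * (diagSeq τ i).1 + (diagSeq τ i).2.1 := fun i => rot_add _ _ _
  have rotS : ∀ i, (diagSeq τ (i + 1)).2.2 * (diagSeq τ (i + 1)).1 - (diagSeq τ (i + 1)).2.1 =
      (diagSeq τ i).1 - (diagSeq τ (i + 1)).2.2 * (diagSeq τ i).2.1 := fun i => rot_sub _ _ _
  have rotA0 : (diagSeq τ 0).1 + (diagSeq τ 0).2.2 * (diagSeq τ 0).2.1 =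
      (diagSeq τ 0).2.2 * 1 + 0 := rot_add _ _ _
  have rotS0 : (diagSeq τ 0).2.2 * (diagSeq τ 0).1 - (diagSeq τ 0).2.1 =
      1 - (diagSeq τ 0).2.2 * 0 := rot_sub _ _ _
  have diag' : ∀ i : ℕ, diagRadius τ (i + 2) *
      ((diagSeq τ (i + 1)).2.2 * (diagSeq τ i).1 + (diagSeq τ i).2.1) = i + 2 := by
    intro i
    have := D1 (i + 1)
    push_cast at this
    rw [← rotA]
    linear_combination this
  -- The kite crossing the diagonal is symmetric under reflection, so its direction determines the
  -- ratio of consecutive diagonal radii. The formula for `nextQuot` is what results from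
  -- eliminating the radii from `D1`, `diag'` and this relation.
  have D2 : ∀ i, diagRadius τ (i + 2) * (diagSeq τ i).2.1 =
      diagRadius τ (i + 1) * (diagSeq τ i).1 := by
    intro i
    have e1 := D1 i
    have e2 := diag' i
    have hrec : (diagSeq τ (i + 1)).2.2 * (((i : ℝ) + 1) * (diagSeq τ i).1 ^ 2) =
        (diagSeq τ i).1 * (diagSeq τ i).2.1 +
          ((i : ℝ) + 1 + 1) * (diagSeq τ i).2.2 * (diagSeq τ i).2.1 ^ 2 :=
      div_mul_cancel₀ _ (mul_ne_zero (Nat.cast_add_one_ne_zero i) (pow_ne_zero 2 (hX i).ne'))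
    have p1 := hX i
    have p2 := hY i
    have p3 := hT i
    have p4 := hT (i + 1)
    have key : ((i : ℝ) + 2) * (diagSeq τ i).2.1 *
        ((diagSeq τ i).1 + (diagSeq τ i).2.1 * (diagSeq τ i).2.2) =
        (i + 1) * (diagSeq τ i).1 *
          ((diagSeq τ (i + 1)).2.2 * (diagSeq τ i).1 + (diagSeq τ i).2.1) := by
      linear_combination -hrec
    apply mul_right_cancel₀ (mul_ne_zero
      (by positivity : (diagSeq τ i).1 + (diagSeq τ i).2.1 * (diagSeq τ i).2.2 ≠ 0)
      (by positivity : (diagSeq τ (i + 1)).2.2 * (diagSeq τ i).1 + (diagSeq τ i).2.1 ≠ 0))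
    calc _ = (diagRadius τ (i + 2) * ((diagSeq τ (i + 1)).2.2 * (diagSeq τ i).1 +
          (diagSeq τ i).2.1)) * ((diagSeq τ i).2.1 *
          ((diagSeq τ i).1 + (diagSeq τ i).2.1 * (diagSeq τ i).2.2)) := by ring
      _ = (i + 2) * (diagSeq τ i).2.1 *
          ((diagSeq τ i).1 + (diagSeq τ i).2.1 * (diagSeq τ i).2.2) := by rw [e2]; ring
      _ = (diagRadius τ (i + 1) * ((diagSeq τ i).1 + (diagSeq τ i).2.1 * (diagSeq τ i).2.2)) *
          ((diagSeq τ i).1 * ((diagSeq τ (i + 1)).2.2 * (diagSeq τ i).1 +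
          (diagSeq τ i).2.1)) := by rw [key, e1]; ring
      _ = _ := by ring
  have first : diagRadius τ 1 * (diagSeq τ 0).2.2 = 1 := by
    have := D1 0
    simp only [zero_add, Nat.cast_zero] at this
    linear_combination this - diagRadius τ 1 * rotA0
  refine ⟨pos, fun m => mul_pos (pos m) (hT m), ?_, by simp [diagDir], ?_, ?_, ?_, ?_, ?_⟩
  · rintro (_ | m)
    · simp [diagDir]
    · exact hX m
  · rintro (_ | m)
    · simp [diagDir]
    · exact diagSeq_unit τ m
  · rintro (_ | m)
    · simp [diagDir, diagRadius.eq_1, first]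
    · simp only [diagDir]
      push_cast
      linear_combination diag' m - D2 m
  · intro m
    simp only [diagDir]
    linear_combination D1 m + D2 m
  · rintro (_ | m)
    · simp [diagDir, first]
    · simp only [diagDir]
      push_cast
      linear_combination diag' m
  · rintro (_ | m)
    · rw [mul_add_I_eq_iff]
      simp only [diagDir, zero_add, Complex.one_re, Complex.one_im]
      exact ⟨by linear_combination diagRadius τ 1 * rotS0,
        by linear_combination diagRadius τ 1 * rotA0⟩
    · rw [mul_add_I_eq_iff]
      simp only [diagDir]
      exact ⟨by linear_combination diagRadius τ (m + 2) * rotS m,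
        by linear_combination diagRadius τ (m + 2) * rotA m⟩

/-- All diagonals of a circle pattern with positive radii. -/
theorem exists_levels : ∃ (A : ℕ → ℕ → ℝ) (e : ℕ → ℕ → ℂ), A 0 0 = 0 ∧
    (∀ j, Level j (A j) (A (j + 1)) (e j)) ∧
    ∀ j m, e (j + 1) m * (A (j + 1) m + A (j + 1) (m + 1) * Complex.I) =
      e j (m + 1) * (A (j + 1) (m + 1) + A (j + 1) m * Complex.I) := by
  obtain ⟨τ, hτ, hgood⟩ := exists_diagGood
  let S : ℕ → (ℕ → ℝ) × (ℕ → ℝ) × (ℕ → ℂ) := fun j => Nat.rec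
    (diagRadius τ, fun m => diagRadius τ (m + 1) * (diagSeq τ m).2.2, diagDir τ)
    (fun j s => (s.2.1, nextRadius j s.2.1 s.2.2, nextDir s.2.1 s.2.2)) j
  have lev : ∀ j, Level j (S j).1 (S j).2.1 (S j).2.2 := by
    intro j
    induction j with
    | zero => exact level_zero hτ hgood
    | succ j ih => exact ih.next
  refine ⟨fun j => (S j).1, fun j => (S j).2.2, rfl, lev, fun j m => ?_⟩
  exact div_mul_cancel₀ _ (add_I_ne_zero (.inl ((lev j).B_pos m)))

/-- An orthogonal circle pattern with the combinatorics of the square grid: `R n m` is the radius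
of the circle with center at a vertex with `n + m` even, `e n m` the direction of the edge to the
right of an intersection point with `n + m` odd. -/
structure Pattern (R : ℕ → ℕ → ℝ) (e : ℕ → ℕ → ℂ) : Prop where
  origin : R 0 0 = 0
  pos : ∀ n m, Even (n + m) → (n, m) ≠ (0, 0) → 0 < R n m
  unit : ∀ n m, Odd (n + m) → (e n m).re ^ 2 + (e n m).im ^ 2 = 1
  re_zero : ∀ m, Odd m → (e 0 m).re = 0
  im_zero : ∀ n, Odd n → (e n 0).im = 0
  hor : ∀ n m, Odd (n + 1 + m) → (e (n + 1) m).re * (R (n + 2) m + R n m) = n + 1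
  ver : ∀ n m, Odd (n + (m + 1)) → (e n (m + 1)).im * (R n (m + 2) + R n m) = m + 1
  diag : ∀ n m, Odd (n + m) →
    R (n + 1) m * (e n m).re + R n (m + 1) * (e n m).im = (n + m + 1) / 2
  ne : ∀ n m, Odd (n + m) → e (n + 1) (m + 1) * (R (n + 1) m + R n (m + 1) * Complex.I) =
    e n m * (R n (m + 1) + R (n + 1) m * Complex.I)
  se : ∀ n m, Even (n + m) → e (n + 1) m * (R n m + R (n + 1) (m + 1) * Complex.I) =
    e n (m + 1) * (R (n + 1) (m + 1) + R n m * Complex.I)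

/-- The reflection of the plane in the diagonal. -/
def swap (z : ℂ) : ℂ := ⟨z.im, z.re⟩

theorem odd_cases {n m : ℕ} (h : Odd (n + m)) :
    (∃ j, n = m + 2 * j + 1) ∨ ∃ j, m = n + 2 * j + 1 := by
  obtain ⟨k, hk⟩ := h
  rcases Nat.lt_or_ge m n with h | h
  · exact .inl ⟨(n - m) / 2, by omega⟩
  · exact .inr ⟨(m - n) / 2, by omega⟩

theorem even_cases {n m : ℕ} (h : Even (n + m)) :
    (∃ j, n = m + 2 * j) ∨ ∃ j, m = n + 2 * j := by
  obtain ⟨k, hk⟩ := h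
  rcases Nat.lt_or_ge m n with h | h
  · exact .inl ⟨(n - m) / 2, by omega⟩
  · exact .inr ⟨(m - n) / 2, by omega⟩

theorem exists_pattern : ∃ (R : ℕ → ℕ → ℝ) (e : ℕ → ℕ → ℂ), Pattern R e := by
  obtain ⟨A, ε, h00, lev, hse⟩ := exists_levels
  let R : ℕ → ℕ → ℝ := fun n m => if m ≤ n then A ((n - m) / 2) m else A ((m - n) / 2) n
  let e : ℕ → ℕ → ℂ := fun n m =>
    if m ≤ n then ε ((n - m) / 2) m else swap (ε ((m - n) / 2) n)
  have Rl : ∀ {n m : ℕ} (j : ℕ), n = m + 2 * j → R n m = A j m := by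
    rintro n m j rfl
    simp [R]
  have Rh : ∀ {n m : ℕ} (j : ℕ), m = n + 2 * j → R n m = A j n := by
    rintro n m j rfl
    rcases j with _ | j
    · simp [R]
    · simp [R]
  have el : ∀ {n m : ℕ} (j : ℕ), n = m + 2 * j + 1 → e n m = ε j m := by
    rintro n m j rfl
    have h1 : m ≤ m + 2 * j + 1 := by omega
    have h2 : (m + 2 * j + 1 - m) / 2 = j := by omega
    simp only [e, if_pos h1, h2]
  have eh : ∀ {n m : ℕ} (j : ℕ), m = n + 2 * j + 1 → e n m = swap (ε j n) := by
    rintro n m j rfl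
    have h1 : ¬ n + 2 * j + 1 ≤ n := by omega
    have h2 : (n + 2 * j + 1 - n) / 2 = j := by omega
    simp only [e, if_neg h1, h2]
  have Apos : ∀ j m, (j, m) ≠ (0, 0) → 0 < A j m := by
    rintro (_ | j) (_ | m) h
    · exact absurd rfl h
    · exact (lev 0).A_pos m
    · exact (lev j).B_pos 0
    · exact (lev j).B_pos (m + 1)
  refine ⟨R, e, ?_, ?_, ?_, ?_, ?_, ?_, ?_, ?_, ?_, ?_⟩
  · rw [Rl 0 rfl, h00]
  · intro n m h h0
    rcases even_cases h with ⟨j, hj⟩ | ⟨j, hj⟩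
    · rw [Rl j hj]
      refine Apos _ _ fun hc => h0 ?_
      simp only [Prod.mk.injEq] at hc ⊢
      omega
    · rw [Rh j hj]
      refine Apos _ _ fun hc => h0 ?_
      simp only [Prod.mk.injEq] at hc ⊢
      omega
  · intro n m h
    rcases odd_cases h with ⟨j, hj⟩ | ⟨j, hj⟩
    · rw [el j hj]; exact (lev j).unit m
    · rw [eh j hj]
      have := (lev j).unit n
      simp only [swap]
      linarith
  · rintro m ⟨j, hj⟩
    rw [eh j (by omega)]
    exact (lev j).im_zero
  · rintro n ⟨j, hj⟩
    rw [el j (by omega)]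
    exact (lev j).im_zero
  · intro n m h
    rcases odd_cases h with ⟨j, hj⟩ | ⟨j, hj⟩
    · rw [el j hj, Rl (j + 1) (by omega), Rl j (by omega)]
      have := (lev j).hor m
      obtain rfl : n = m + 2 * j := by omega
      push_cast
      linear_combination this
    · rw [eh j hj, Rh j (by omega), Rh (j + 1) (by omega)]
      exact (lev j).ver n
  · intro n m h
    rcases odd_cases h with ⟨j, hj⟩ | ⟨j, hj⟩
    · rw [el j hj, Rl j (by omega), Rl (j + 1) (by omega)]
      exact (lev j).ver m
    · rw [eh j hj, Rh (j + 1) (by omega), Rh j (by omega)]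
      have := (lev j).hor n
      obtain rfl : m = n + 2 * j := by omega
      simp only [swap]
      push_cast
      linear_combination this
  · intro n m h
    rcases odd_cases h with ⟨j, hj⟩ | ⟨j, hj⟩
    · rw [el j hj, Rl (j + 1) (by omega), Rl j (by omega)]
      have := (lev j).diag m
      rw [hj]
      push_cast
      linear_combination this
    · rw [eh j hj, Rh j (by omega), Rh (j + 1) (by omega)]
      have := (lev j).diag n
      rw [hj]
      simp only [swap]
      push_cast
      linear_combination this
  · intro n m h
    rcases odd_cases h with ⟨j, hj⟩ | ⟨j, hj⟩
    · rw [el j hj, el (m := m + 1) j (by omega), Rl (j + 1) (by omega), Rl j (by omega)]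
      exact (lev j).ne m
    · rw [eh j hj, eh (n := n + 1) j (by omega), Rh j (by omega), Rh (j + 1) (by omega)]
      have := (lev j).ne n
      rw [mul_add_I_eq_iff] at this ⊢
      simp only [swap]
      exact ⟨by linear_combination -this.1, by linear_combination this.2⟩
  · intro n m h
    rcases even_cases h with ⟨j, hj⟩ | ⟨j, hj⟩
    -- For j = 0 the kite crosses the main diagonal and both of its directions come from the same
    -- entry by reflection; the relation is then the difference of `hor` and `diag`.
    · rcases j with _ | j
      · obtain rfl : n = m := by omega
        rw [el (m := n) 0 (by omega), eh (n := n) 0 (by omega), Rl 0 (by omega), Rl 0 (by omega)]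
        have h1 := (lev 0).hor n
        have h2 := (lev 0).diag n
        rw [mul_add_I_eq_iff]
        simp only [swap]
        push_cast at h1 h2
        exact ⟨by linear_combination 2 * h1 - 2 * h2, by ring⟩
      · rw [el (m := m) (j + 1) (by omega), el (m := m + 1) j (by omega), Rl (j + 1) hj,
          Rl (j + 1) (by omega)]
        exact hse j m
    · rcases j with _ | j
      · obtain rfl : n = m := by omega
        rw [el (m := n) 0 (by omega), eh (n := n) 0 (by omega), Rl 0 (by omega), Rl 0 (by omega)]
        have h1 := (lev 0).hor n
        have h2 := (lev 0).diag n
        rw [mul_add_I_eq_iff]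
        simp only [swap]
        push_cast at h1 h2
        exact ⟨by linear_combination 2 * h1 - 2 * h2, by ring⟩
      · rw [eh (n := n) (j + 1) (by omega), eh (n := n + 1) j (by omega), Rh (j + 1) hj,
          Rh (j + 1) (by omega)]
        have := hse j n
        rw [mul_add_I_eq_iff] at this ⊢
        simp only [swap]
        exact ⟨by linear_combination this.1, by linear_combination -this.2⟩

/-! ### Signs, axes and the radius at (1, 1). -/

namespace Pattern

variable {R : ℕ → ℕ → ℝ} {e : ℕ → ℕ → ℂ}

theorem nonneg (P : Pattern R e) {n m : ℕ} (h : Even (n + m)) : 0 ≤ R n m := by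
  by_cases h0 : (n, m) = (0, 0)
  · simp only [Prod.mk.injEq] at h0
    rw [h0.1, h0.2, P.origin]
  · exact (P.pos n m h h0).le

theorem re_pos (P : Pattern R e) {n m : ℕ} (h : Odd (n + 1 + m)) : 0 < (e (n + 1) m).re := by
  have h1 := P.pos (n + 2) m (by rw [Nat.odd_iff] at h; rw [Nat.even_iff]; omega) (by simp)
  have h2 := P.nonneg (n := n) (m := m) (by rw [Nat.odd_iff] at h; rw [Nat.even_iff]; omega)
  have h3 := P.hor n m h
  by_contra hc
  have := mul_nonpos_of_nonpos_of_nonneg (not_lt.1 hc) (add_nonneg h1.le h2)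
  have : (0 : ℝ) < n + 1 := by positivity
  linarith

theorem im_pos (P : Pattern R e) {n m : ℕ} (h : Odd (n + (m + 1))) : 0 < (e n (m + 1)).im := by
  have h1 := P.pos n (m + 2) (by rw [Nat.odd_iff] at h; rw [Nat.even_iff]; omega) (by simp)
  have h2 := P.nonneg (n := n) (m := m) (by rw [Nat.odd_iff] at h; rw [Nat.even_iff]; omega)
  have h3 := P.ver n m h
  by_contra hc
  have := mul_nonpos_of_nonpos_of_nonneg (not_lt.1 hc) (add_nonneg h1.le h2)
  have : (0 : ℝ) < m + 1 := by positivity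
  linarith

theorem re_nonneg (P : Pattern R e) {n m : ℕ} (h : Odd (n + m)) : 0 ≤ (e n m).re := by
  rcases n with _ | n
  · exact (P.re_zero m (by simpa using h)).ge
  · exact (P.re_pos h).le

theorem im_nonneg (P : Pattern R e) {n m : ℕ} (h : Odd (n + m)) : 0 ≤ (e n m).im := by
  rcases m with _ | m
  · exact (P.im_zero n (by simpa using h)).ge
  · exact (P.im_pos h).le

theorem norm_eq (P : Pattern R e) {n m : ℕ} (h : Odd (n + m)) : ‖e n m‖ = 1 := by
  have h1 := P.unit n m h
  rw [← sq_eq_sq₀ (norm_nonneg _) zero_le_one, Complex.sq_norm, Complex.normSq_apply]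
  linarith

theorem ne_zero (P : Pattern R e) {n m : ℕ} (h : Odd (n + m)) : e n m ≠ 0 := by
  rw [← norm_pos_iff, P.norm_eq h]; exact one_pos

theorem axis_hor (P : Pattern R e) {n : ℕ} (h : Odd n) : e n 0 = 1 := by
  have h1 := P.im_zero n h
  have h2 := P.unit n 0 h
  rcases n with _ | n
  · simp at h
  have h3 := P.re_pos (n := n) (m := 0) h
  rw [h1] at h2
  apply Complex.ext
  · simp only [Complex.one_re]; nlinarith
  · simpa using h1

theorem axis_ver (P : Pattern R e) {m : ℕ} (h : Odd m) : e 0 m = Complex.I := by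
  have h1 := P.re_zero m h
  have h2 := P.unit 0 m (by simpa using h)
  rcases m with _ | m
  · simp at h
  have h3 := P.im_pos (n := 0) (m := m) (by simpa using h)
  rw [h1] at h2
  apply Complex.ext
  · simpa using h1
  · simp only [Complex.I_im]; nlinarith

theorem radius_hor (P : Pattern R e) (k : ℕ) : R (2 * k) 0 = k := by
  induction k with
  | zero => simpa using P.origin
  | succ k ih =>
    have h : Odd (2 * k + 1 + 0) := ⟨k, by ring⟩
    have h1 := P.hor (2 * k) 0 h
    rw [P.axis_hor (by simp), ih] at h1
    rw [show 2 * (k + 1) = 2 * k + 2 by ring]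
    simp only [Complex.one_re, one_mul] at h1
    push_cast at h1 ⊢
    linarith

theorem radius_ver (P : Pattern R e) (k : ℕ) : R 0 (2 * k) = k := by
  induction k with
  | zero => simpa using P.origin
  | succ k ih =>
    have h : Odd (0 + (2 * k + 1)) := ⟨k, by ring⟩
    have h1 := P.ver 0 (2 * k) h
    rw [P.axis_ver (by simp), ih] at h1
    rw [show 2 * (k + 1) = 2 * k + 2 by ring]
    simp only [Complex.I_im, one_mul] at h1
    push_cast at h1 ⊢
    linarith

/-- The direction at (2k+2, 1) is computed from the radii of the kites on its left and on its right,
with the axis radius k + 1 in both. Equating them gives ρ_k ρ_{k+1} = (k+1)² for the radii in the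
row m = 1, and positivity of its imaginary part gives ρ_k < k + 1. -/
theorem radius_one_one (P : Pattern R e) : R 1 1 = 2 / Real.pi := by
  have pos : ∀ k, 0 < R (2 * k + 1) 1 := fun k => P.pos _ _ ⟨k + 1, by ring⟩ (by simp)
  have ne : ∀ k : ℕ, e (2 * k + 2) 1 * (((k + 1 : ℕ) : ℝ) + R (2 * k + 1) 1 * Complex.I) =
      1 * (R (2 * k + 1) 1 + ((k + 1 : ℕ) : ℝ) * Complex.I) := by
    intro k
    have h := P.ne (2 * k + 1) 0 ⟨k, by ring⟩
    rw [P.axis_hor ⟨k, rfl⟩, show 2 * k + 1 + 1 = 2 * (k + 1) by ring, P.radius_hor] at h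
    exact h
  have se : ∀ k : ℕ, 1 * (((k + 1 : ℕ) : ℝ) + R (2 * (k + 1) + 1) 1 * Complex.I) =
      e (2 * k + 2) 1 * (R (2 * (k + 1) + 1) 1 + ((k + 1 : ℕ) : ℝ) * Complex.I) := by
    intro k
    have h := P.se (2 * (k + 1)) 0 ⟨k + 1, by ring⟩
    rw [P.axis_hor ⟨k + 1, rfl⟩, P.radius_hor] at h
    exact h
  refine wallis_initial_value (fun k => R (2 * k + 1) 1) pos (fun k => ?_) (fun k => ?_)
  · obtain ⟨n1, n2⟩ := (mul_add_I_eq_iff _ _ _ _ _ _).1 (ne k)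
    have hp := pos k
    have him : 0 < (e (2 * k + 2) 1).im := P.im_pos (n := 2 * k + 2) (m := 0) ⟨k + 1, by ring⟩
    simp only [Complex.one_re, Complex.one_im] at n1 n2
    push_cast at n1 n2
    have key : (e (2 * k + 2) 1).im * (((k : ℝ) + 1) ^ 2 + R (2 * k + 1) 1 ^ 2) =
        ((k : ℝ) + 1) ^ 2 - R (2 * k + 1) 1 ^ 2 := by
      linear_combination ((k : ℝ) + 1) * n2 - R (2 * k + 1) 1 * n1
    have h1 : 0 < ((k : ℝ) + 1) ^ 2 - R (2 * k + 1) 1 ^ 2 := by rw [← key]; positivity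
    have h2 : (0 : ℝ) < k + 1 := by positivity
    show R (2 * k + 1) 1 < k + 1
    nlinarith
  · obtain ⟨n1, n2⟩ := (mul_add_I_eq_iff _ _ _ _ _ _).1 (ne k)
    obtain ⟨s1, s2⟩ := (mul_add_I_eq_iff _ _ _ _ _ _).1 (se k)
    simp only [Complex.one_re, Complex.one_im] at n1 n2 s1 s2
    push_cast at n1 n2 s1 s2
    have h2 : (k : ℝ) + 1 ≠ 0 := by positivity
    show R (2 * k + 1) 1 * R (2 * (k + 1) + 1) 1 = (k + 1) ^ 2
    apply mul_left_cancel₀ h2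
    set κ : ℝ := k + 1
    set ρ := R (2 * k + 1) 1
    set ρ' := R (2 * (k + 1) + 1) 1
    linear_combination -((κ ^ 2 + ρ ^ 2) / 2) * s1 - (κ * n1 + ρ * n2) * ρ' / 2 +
      (κ * n2 - ρ * n1) * κ / 2

end Pattern
end DiscreteConformal

/-! ### The discrete z² as an integral of the pattern. -/

namespace DiscreteConformal

/-- A map of the quadrant whose elementary quadrilaterals (except the one at the origin) are kites
with right angles at the vertices with `n + m` odd, and with side lengths `ρ` at the other
vertices. -/
structure KiteMap (f : ℕ → ℕ → ℂ) (ρ : ℕ → ℕ → ℝ) (ε : ℕ → ℕ → ℂ) : Prop where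
  pos : ∀ n m, Even (n + m) → (n, m) ≠ (0, 0) → 0 < ρ n m
  norm_eq : ∀ n m, Odd (n + m) → ‖ε n m‖ = 1
  hor_odd : ∀ n m, Odd (n + m) → f (n + 1) m - f n m = ε n m * ρ (n + 1) m
  hor_even : ∀ n m, Even (n + m) → (n, m) ≠ (0, 0) → f (n + 1) m - f n m = ε (n + 1) m * ρ n m
  ver_odd : ∀ n m, Odd (n + m) → f n (m + 1) - f n m = Complex.I * ε n m * ρ n (m + 1)
  ver_even : ∀ n m, Even (n + m) → (n, m) ≠ (0, 0) →
    f n (m + 1) - f n m = Complex.I * ε n (m + 1) * ρ n m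

namespace Pattern

variable {R : ℕ → ℕ → ℝ} {e : ℕ → ℕ → ℂ}

/-- The value of the discrete `z²` at an intersection point. -/
noncomputable def z2Odd (R : ℕ → ℕ → ℝ) (e : ℕ → ℕ → ℂ) (n m : ℕ) : ℂ :=
  e n m * (R (n + 1) m * (n - (e n m).re * R (n + 1) m) +
    Complex.I * (R n (m + 1) * (m - (e n m).im * R n (m + 1))))

/-- The discrete `z²`. -/
noncomputable def z2 (R : ℕ → ℕ → ℝ) (e : ℕ → ℕ → ℂ) (n m : ℕ) : ℂ :=
  if Odd (n + m) then z2Odd R e n m else z2Odd R e (n + 1) m - e (n + 1) m * R n m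

/-- By `hor` both sides are Re e · R_left · R_right. Constraint (2) at an intersection point reads f
= e (Re e · R_left R_right + i Im e · R_down R_up), so this product, written with one neighbor only,
is the one in `z2Odd`. -/
theorem hor_swap (P : Pattern R e) {n m : ℕ} (h : Odd (n + 1 + m)) :
    R (n + 2) m * (n + 1 - (e (n + 1) m).re * R (n + 2) m) =
      R n m * (n + 1 - (e (n + 1) m).re * R n m) := by
  linear_combination (R n m - R (n + 2) m) * P.hor n m h

theorem ver_swap (P : Pattern R e) {n m : ℕ} (h : Odd (n + (m + 1))) :
    R n (m + 2) * (m + 1 - (e n (m + 1)).im * R n (m + 2)) =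
      R n m * (m + 1 - (e n (m + 1)).im * R n m) := by
  linear_combination (R n m - R n (m + 2)) * P.ver n m h

/-- The increment is that of the path through the center (n+1, m). Hence the values dictated by the
constraint at the intersection points are compatible with the edges of the pattern. -/
theorem z2Odd_ne (P : Pattern R e) {n m : ℕ} (h : Odd (n + m)) :
    z2Odd R e (n + 1) (m + 1) - z2Odd R e n m =
      R (n + 1) m * (e n m + Complex.I * e (n + 1) (m + 1)) := by
  have hne := P.ne n m h
  obtain ⟨n1, n2⟩ := (mul_add_I_eq_iff _ _ _ _ _ _).1 hne
  have hK := P.diag n m h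
  have h1 : Odd (n + 1 + (m + 1)) := by rw [Nat.odd_iff] at *; omega
  have hs := P.hor_swap (n := n) (m := m + 1) h1
  have vs := P.ver_swap (n := n + 1) (m := m) h1
  have hq := P.pos (n + 1) m (by rw [Nat.odd_iff] at h; rw [Nat.even_iff]; omega) (by simp)
  -- The swaps express the value at the far vertex by the two radii of the kite itself.
  have e1 : z2Odd R e (n + 1) (m + 1) = e (n + 1) (m + 1) * (
      (R n (m + 1) * (n + 1 - (e (n + 1) (m + 1)).re * R n (m + 1)) : ℝ) +
    Complex.I * (R (n + 1) m * (m + 1 - (e (n + 1) (m + 1)).im * R (n + 1) m) : ℝ)) := by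
    rw [← hs, ← vs]; unfold z2Odd; push_cast; ring
  have e2 : z2Odd R e n m = e n m * ((R (n + 1) m * (n - (e n m).re * R (n + 1) m) : ℝ) +
    Complex.I * (R n (m + 1) * (m - (e n m).im * R n (m + 1)) : ℝ)) := by
    unfold z2Odd; push_cast; ring
  rw [e1, e2]
  set q := R (n + 1) m
  set u := R n (m + 1)
  set E := e n m
  set E' := e (n + 1) (m + 1)
  have hD : q ^ 2 + u ^ 2 ≠ 0 := by positivity
  have k1 : (E'.re + E.im) * (q ^ 2 + u ^ 2) = u * (n + m + 1) := by
    linear_combination q * n1 + u * n2 + 2 * u * hK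
  have k2 : (E.re + E'.im) * (q ^ 2 + u ^ 2) = q * (n + m + 1) := by
    linear_combination q * n2 - u * n1 + 2 * q * hK
  have re_eq : u * (u * (n + 1 - E'.re * u)) - q * (q * (m - E'.im * q)) =
      q * (q * (n + 1 - E.re * q)) - u * (u * (m - E.im * u)) := by
    apply mul_right_cancel₀ hD
    linear_combination -u ^ 3 * k1 + q ^ 3 * k2
  have im_eq : q * (u * (n + 1 - E'.re * u)) + u * (q * (m - E'.im * q)) =
      u * (q * (n + 1 - E.re * q)) + q * (u * (m - E.im * u)) := by
    linear_combination -u * q * n2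
  have prod : (u + q * Complex.I) * ((u * (n + 1 - E'.re * u) : ℝ) +
      Complex.I * (q * (m - E'.im * q) : ℝ)) =
      (q + u * Complex.I) * ((q * (n + 1 - E.re * q) : ℝ) +
        Complex.I * (u * (m - E.im * u) : ℝ)) := by
    apply Complex.ext
    · simp only [Complex.mul_re, Complex.add_re, Complex.add_im, Complex.ofReal_re,
        Complex.ofReal_im, Complex.mul_im, Complex.I_re, Complex.I_im]
      linear_combination re_eq
    · simp only [Complex.mul_re, Complex.add_re, Complex.add_im, Complex.ofReal_re,
        Complex.ofReal_im, Complex.mul_im, Complex.I_re, Complex.I_im]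
      linear_combination im_eq
  have c1 : (q + u * Complex.I : ℂ) ≠ 0 := add_I_ne_zero (.inl hq)
  apply mul_right_cancel₀ c1
  push_cast at prod ⊢
  linear_combination (u * (n + 1 - E'.re * u) + Complex.I * (q * (m - E'.im * q)) : ℂ) * hne +
    E * prod

theorem z2Odd_se (P : Pattern R e) {n m : ℕ} (h : Even (n + m)) :
    z2Odd R e (n + 1) m - z2Odd R e n (m + 1) =
      R n m * (e (n + 1) m - Complex.I * e n (m + 1)) := by
  have hse := P.se n m h
  obtain ⟨n1, n2⟩ := (mul_add_I_eq_iff _ _ _ _ _ _).1 hse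
  have h1 : Odd (n + (m + 1)) := by rw [Nat.even_iff] at *; rw [Nat.odd_iff]; omega
  have h2 : Odd (n + 1 + m) := by rw [Nat.even_iff] at *; rw [Nat.odd_iff]; omega
  have hs := P.hor_swap h2
  have vs := P.ver_swap h1
  have hK : R (n + 1) (m + 1) * (e n (m + 1)).re - R n m * (e n (m + 1)).im = (n - m) / 2 := by
    have d1 := P.diag n (m + 1) h1
    have d2 := P.ver n m h1
    push_cast at d1
    linear_combination d1 - d2
  have hq := P.pos (n + 1) (m + 1) (by rw [Nat.even_iff] at *; omega) (by simp)
  have e1 : z2Odd R e (n + 1) m = e (n + 1) m * (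
      (R n m * (n + 1 - (e (n + 1) m).re * R n m) : ℝ) +
    Complex.I * (R (n + 1) (m + 1) * (m - (e (n + 1) m).im * R (n + 1) (m + 1)) : ℝ)) := by
    rw [← hs]; unfold z2Odd; push_cast; ring
  have e2 : z2Odd R e n (m + 1) = e n (m + 1) * (
      (R (n + 1) (m + 1) * (n - (e n (m + 1)).re * R (n + 1) (m + 1)) : ℝ) +
    Complex.I * (R n m * (m + 1 - (e n (m + 1)).im * R n m) : ℝ)) := by
    rw [← vs]; unfold z2Odd; push_cast; ring
  rw [e1, e2]
  set q := R (n + 1) (m + 1)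
  set p := R n m
  set E := e n (m + 1)
  set F := e (n + 1) m
  have hD : p ^ 2 + q ^ 2 ≠ 0 := by positivity
  have k1 : (F.re - E.im) * (p ^ 2 + q ^ 2) = p * (n - m) := by
    linear_combination p * n1 + q * n2 + 2 * p * hK
  have k2 : (E.re - F.im) * (p ^ 2 + q ^ 2) = q * (n - m) := by
    linear_combination q * n1 - p * n2 + 2 * q * hK
  have re_eq : q * (p * (n - F.re * p)) - p * (q * (m - F.im * q)) =
      p * (q * (n - E.re * q)) - q * (p * (m - E.im * p)) := by
    linear_combination -p * q * n1
  have im_eq : p * (p * (n - F.re * p)) + q * (q * (m - F.im * q)) =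
      q * (q * (n - E.re * q)) + p * (p * (m - E.im * p)) := by
    apply mul_right_cancel₀ hD
    linear_combination -p ^ 3 * k1 + q ^ 3 * k2
  have prod : (q + p * Complex.I) * ((p * (n - F.re * p) : ℝ) +
      Complex.I * (q * (m - F.im * q) : ℝ)) =
      (p + q * Complex.I) * ((q * (n - E.re * q) : ℝ) +
        Complex.I * (p * (m - E.im * p) : ℝ)) := by
    apply Complex.ext
    · simp only [Complex.mul_re, Complex.add_re, Complex.add_im, Complex.ofReal_re,
        Complex.ofReal_im, Complex.mul_im, Complex.I_re, Complex.I_im]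
      linear_combination re_eq
    · simp only [Complex.mul_re, Complex.add_re, Complex.add_im, Complex.ofReal_re,
        Complex.ofReal_im, Complex.mul_im, Complex.I_re, Complex.I_im]
      linear_combination im_eq
  have c1 : (p + q * Complex.I : ℂ) ≠ 0 := add_I_ne_zero (.inr hq)
  apply mul_right_cancel₀ c1
  push_cast at prod ⊢
  linear_combination (p * (n - F.re * p) + Complex.I * (q * (m - F.im * q)) : ℂ) * hse + E * prod

/-- The value at a center is defined through its right neighbor; the left neighbor is reached from
there by two diagonal steps, over the upper neighbor. -/
theorem z2_hor_odd (P : Pattern R e) {n m : ℕ} (h : Odd (n + m)) :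
    z2 R e (n + 1) m - z2 R e n m = e n m * R (n + 1) m := by
  have h1 : ¬ Odd (n + 1 + m) := by rw [Nat.odd_iff] at *; omega
  rw [z2, if_neg h1, z2, if_pos h]
  linear_combination P.z2Odd_ne h +
    P.z2Odd_se (n := n + 1) (m := m) (Nat.not_odd_iff_even.1 h1)

theorem z2_hor_even {n m : ℕ} (h : Even (n + m)) :
    z2 R e (n + 1) m - z2 R e n m = e (n + 1) m * R n m := by
  have h1 : Odd (n + 1 + m) := by rw [Nat.even_iff] at *; rw [Nat.odd_iff]; omega
  rw [z2, if_pos h1, z2, if_neg (Nat.not_odd_iff_even.2 h)]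
  ring

theorem z2_ver_odd (P : Pattern R e) {n m : ℕ} (h : Odd (n + m)) :
    z2 R e n (m + 1) - z2 R e n m = Complex.I * e n m * R n (m + 1) := by
  have h1 : ¬ Odd (n + (m + 1)) := by rw [Nat.odd_iff] at *; omega
  rw [z2, if_neg h1, z2, if_pos h]
  linear_combination P.z2Odd_ne h + Complex.I * P.ne n m h -
    (R n (m + 1) * e (n + 1) (m + 1) - R (n + 1) m * e n m) * Complex.I_sq

theorem z2_ver_even (P : Pattern R e) {n m : ℕ} (h : Even (n + m)) :
    z2 R e n (m + 1) - z2 R e n m = Complex.I * e n (m + 1) * R n m := by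
  have h1 : Odd (n + (m + 1)) := by rw [Nat.even_iff] at *; rw [Nat.odd_iff]; omega
  rw [z2, if_pos h1, z2, if_neg (Nat.not_odd_iff_even.2 h)]
  linear_combination -P.z2Odd_se h

theorem kiteMap_z2 (P : Pattern R e) : KiteMap (z2 R e) R e where
  pos := P.pos
  norm_eq _ _ h := P.norm_eq h
  hor_odd _ _ h := P.z2_hor_odd h
  hor_even _ _ h _ := z2_hor_even h
  ver_odd _ _ h := P.z2_ver_odd h
  ver_even _ _ h _ := P.z2_ver_even h

/-! ### The constraints at the centers of the circles. -/

/-- The relations around an interior center. -/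
theorem center_relations (P : Pattern R e) {n m : ℕ} (h : Even (n + m)) :
    ((n + 1 : ℕ) : ℂ) * (2 * Complex.I * R (n + 1) (m + 1) * e (n + 1) (m + 2)) =
      (e (n + 2) (m + 1) + e n (m + 1)) * ((e (n + 1) (m + 2)).re *
        ((R (n + 1) (m + 1) + R (n + 2) (m + 2) * Complex.I) *
          (R n (m + 2) + R (n + 1) (m + 1) * Complex.I))) ∧
    ((m + 1 : ℕ) : ℂ) * (2 * Complex.I * R (n + 1) (m + 1) * e (n + 1) (m + 2)) =
      (e (n + 1) (m + 2) + e (n + 1) m) * ((e n (m + 1)).im *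
        ((R n (m + 2) + R (n + 1) (m + 1) * Complex.I) *
          (R n m + R (n + 1) (m + 1) * Complex.I))) := by
  have o1 : Odd (n + (m + 1)) := by rw [Nat.even_iff] at *; rw [Nat.odd_iff]; omega
  have o2 : Odd (n + 1 + (m + 2)) := by rw [Nat.even_iff] at *; rw [Nat.odd_iff]; omega
  have hne := P.ne n (m + 1) o1
  have hse := P.se n m h
  have hse' := P.se (n + 1) (m + 1) (by rw [Nat.even_iff] at *; omega)
  have hN := P.hor n (m + 2) o2
  have hM := P.ver n m o1
  have hN' : ((e (n + 1) (m + 2)).re : ℂ) * (R (n + 2) (m + 2) + R n (m + 2)) =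
    ((n + 1 : ℕ) : ℂ) := by exact_mod_cast congrArg (fun x : ℝ => (x : ℂ)) hN
  have hM' : ((e n (m + 1)).im : ℂ) * (R n (m + 2) + R n m) = ((m + 1 : ℕ) : ℂ) := by
    exact_mod_cast congrArg (fun x : ℝ => (x : ℂ)) hM
  rw [← hN', ← hM']
  change e (n + 1) (m + 2) * (R (n + 1) (m + 1) + R n (m + 2) * Complex.I) = _ at hne
  change e (n + 2) (m + 1) * (R (n + 1) (m + 1) + R (n + 2) (m + 2) * Complex.I) =
    e (n + 1) (m + 2) * (R (n + 2) (m + 2) + R (n + 1) (m + 1) * Complex.I) at hse'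
  constructor
  · linear_combination (-((e (n + 1) (m + 2)).re : ℂ) *
      (R n (m + 2) + R (n + 1) (m + 1) * Complex.I)) * hse' +
      ((e (n + 1) (m + 2)).re : ℂ) *
        (R (n + 1) (m + 1) + R (n + 2) (m + 2) * Complex.I) * hne -
      ((e (n + 1) (m + 2)).re : ℂ) * e (n + 1) (m + 2) *
        (R (n + 2) (m + 2) * R n (m + 2) + R (n + 1) (m + 1) ^ 2) * Complex.I_sq
  · linear_combination (-((e n (m + 1)).im : ℂ) *
      (R n (m + 2) + R (n + 1) (m + 1) * Complex.I)) * hse + ((e n (m + 1)).im : ℂ) *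
      (R (n + 1) (m + 1) + R n m * Complex.I) * hne -
      ((e n (m + 1)).im : ℂ) * e (n + 1) (m + 2) *
        (R n m * R n (m + 2) + R (n + 1) (m + 1) ^ 2) * Complex.I_sq

/-- The real relations around an interior center. -/
theorem center_relations_real (P : Pattern R e) {n m : ℕ} (h : Even (n + m)) :
    R (n + 1) (m + 1) * (e n (m + 1)).re + R n (m + 2) * (e n (m + 1)).im = (n + m + 2) / 2 ∧
    R (n + 1) (m + 1) * (e (n + 1) (m + 2)).im + R n (m + 2) * (e (n + 1) (m + 2)).re =
      (n + m + 2) / 2 ∧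
    ((e (n + 1) (m + 2)).re + (e n (m + 1)).im) *
      (R (n + 1) (m + 1) ^ 2 + R n (m + 2) ^ 2) = R n (m + 2) * (n + m + 2) := by
  have o1 : Odd (n + (m + 1)) := by rw [Nat.even_iff] at *; rw [Nat.odd_iff]; omega
  have hne := P.ne n (m + 1) o1
  have hK := P.diag n (m + 1) o1
  change e (n + 1) (m + 2) * (R (n + 1) (m + 1) + R n (m + 2) * Complex.I) =
    e n (m + 1) * (R n (m + 2) + R (n + 1) (m + 1) * Complex.I) at hne
  change R (n + 1) (m + 1) * (e n (m + 1)).re + R n (m + 2) * (e n (m + 1)).im = _ at hK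
  obtain ⟨n1, n2⟩ := (mul_add_I_eq_iff _ _ _ _ _ _).1 hne
  push_cast at hK
  exact ⟨by linear_combination hK, by linear_combination hK + n2,
    by linear_combination R (n + 1) (m + 1) * n1 + R n (m + 2) * n2 + 2 * R n (m + 2) * hK⟩

/-- Constraint (3) at a center for the edges 1/(e R), cleared of denominators. The relations of
`center_relations` replace n + 1 and m + 1 by multiples of the sums of opposite directions, so that
a single scalar identity remains. -/
theorem log_center (P : Pattern R e) {n m : ℕ} (h : Even (n + m)) :
    ((n + 1 : ℕ) : ℂ) * (e (n + 1) (m + 2) + e (n + 1) m) +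
      Complex.I * ((m + 1 : ℕ) : ℂ) * (e (n + 2) (m + 1) + e n (m + 1)) =
      R (n + 1) (m + 1) * ((e (n + 1) (m + 2) + e (n + 1) m) *
        (e (n + 2) (m + 1) + e n (m + 1))) := by
  obtain ⟨a, b⟩ := P.center_relations h
  obtain ⟨k1, k2, k3⟩ := P.center_relations_real h
  have o1 : Odd (n + (m + 1)) := by rw [Nat.even_iff] at *; rw [Nat.odd_iff]; omega
  have o2 : Odd (n + 1 + (m + 2)) := by rw [Nat.even_iff] at *; rw [Nat.odd_iff]; omega
  have hN := P.hor n (m + 2) o2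
  have hM := P.ver n m o1
  have hq := P.pos (n + 1) (m + 1) (by rw [Nat.even_iff] at *; omega) (by simp)
  have hE' := P.ne_zero o2
  -- Compared by real and imaginary parts; `diag` enters through k2 and k3.
  have key : (R n (m + 2) + R (n + 1) (m + 1) * Complex.I : ℂ) *
      ((e (n + 1) (m + 2)).re * (R (n + 1) (m + 1) + R (n + 2) (m + 2) * Complex.I) +
        Complex.I * (e n (m + 1)).im * (R n m + R (n + 1) (m + 1) * Complex.I)) =
      2 * Complex.I * R (n + 1) (m + 1) ^ 2 * e (n + 1) (m + 2) := by
    apply Complex.ext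
    · simp [pow_two]
      linear_combination -(R (n + 1) (m + 1)) * hN - R (n + 1) (m + 1) * hM +
        2 * R (n + 1) (m + 1) * k2
    · simp [pow_two]
      linear_combination R n (m + 2) * hN + R n (m + 2) * hM - k3
  set q := R (n + 1) (m + 1)
  have hq' : (q : ℂ) ≠ 0 := by exact_mod_cast hq.ne'
  have c : (2 * Complex.I * q * e (n + 1) (m + 2) : ℂ) ≠ 0 := by
    simp [hq', hE', Complex.I_ne_zero]
  apply mul_right_cancel₀ c
  linear_combination (e (n + 1) (m + 2) + e (n + 1) m) * a +
    Complex.I * (e (n + 2) (m + 1) + e n (m + 1)) * b +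
    (e (n + 1) (m + 2) + e (n + 1) m) * (e (n + 2) (m + 1) + e n (m + 1)) * key

/-- Constraint (2) with γ = 2 at a center for the edges e R, cleared of denominators; the strategy
is that of `log_center`, with the value at the center taken from its left neighbor. -/
theorem z2_center (P : Pattern R e) {n m : ℕ} (h : Even (n + m)) :
    z2 R e (n + 1) (m + 1) * ((e (n + 1) (m + 2) + e (n + 1) m) *
        (e (n + 2) (m + 1) + e n (m + 1))) =
      R (n + 1) (m + 1) * (((n + 1 : ℕ) : ℂ) * e (n + 2) (m + 1) * e n (m + 1) *
          (e (n + 1) (m + 2) + e (n + 1) m) +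
        Complex.I * ((m + 1 : ℕ) : ℂ) * e (n + 1) (m + 2) * e (n + 1) m *
          (e (n + 2) (m + 1) + e n (m + 1))) := by
  obtain ⟨a, b⟩ := P.center_relations h
  obtain ⟨k1, k2, k3⟩ := P.center_relations_real h
  have o1 : Odd (n + (m + 1)) := by rw [Nat.even_iff] at *; rw [Nat.odd_iff]; omega
  have o2 : Odd (n + 1 + (m + 2)) := by rw [Nat.even_iff] at *; rw [Nat.odd_iff]; omega
  have hN := P.hor n (m + 2) o2
  have hM := P.ver n m o1
  have hq := P.pos (n + 1) (m + 1) (by rw [Nat.even_iff] at *; omega) (by simp)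
  have hE' := P.ne_zero o2
  have hne : e (n + 1) (m + 2) * (R (n + 1) (m + 1) + R n (m + 2) * Complex.I) =
    e n (m + 1) * (R n (m + 2) + R (n + 1) (m + 1) * Complex.I) := P.ne n (m + 1) o1
  have hse := P.se n m h
  have hse' : e (n + 2) (m + 1) * (R (n + 1) (m + 1) + R (n + 2) (m + 2) * Complex.I) =
    e (n + 1) (m + 2) * (R (n + 2) (m + 2) + R (n + 1) (m + 1) * Complex.I) :=
    P.se (n + 1) (m + 1) (by rw [Nat.even_iff] at *; omega)
  have value : z2 R e (n + 1) (m + 1) = e n (m + 1) *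
      ((R (n + 1) (m + 1) * (n + 1 - (e n (m + 1)).re * R (n + 1) (m + 1)) : ℝ) +
        Complex.I * (R n (m + 2) * (m + 1 - (e n (m + 1)).im * R n (m + 2)) : ℝ)) := by
    have h1 := P.z2_hor_odd o1
    rw [sub_eq_iff_eq_add] at h1
    rw [h1, z2, if_pos o1, z2Odd]
    push_cast
    ring
  have key : 2 * Complex.I *
      ((R (n + 1) (m + 1) * (n + 1 - (e n (m + 1)).re * R (n + 1) (m + 1)) : ℝ) +
        Complex.I * (R n (m + 2) * (m + 1 - (e n (m + 1)).im * R n (m + 2)) : ℝ)) =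
      (R n (m + 2) + R (n + 1) (m + 1) * Complex.I : ℂ) *
      ((e (n + 1) (m + 2)).re * (R (n + 2) (m + 2) + R (n + 1) (m + 1) * Complex.I) +
        Complex.I * (e n (m + 1)).im * (R (n + 1) (m + 1) + R n m * Complex.I)) := by
    apply Complex.ext
    · simp
      linear_combination -(R n (m + 2)) * hN + R n (m + 2) * hM + k3
    · simp
      linear_combination -(R (n + 1) (m + 1)) * hN + R (n + 1) (m + 1) * hM -
        2 * R (n + 1) (m + 1) * k1
  rw [value]
  generalize ((R (n + 1) (m + 1) * (n + 1 - (e n (m + 1)).re * R (n + 1) (m + 1)) : ℝ) +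
        Complex.I * (R n (m + 2) * (m + 1 - (e n (m + 1)).im * R n (m + 2)) : ℝ) : ℂ) = V at *
  set q : ℂ := (R (n + 1) (m + 1) : ℂ)
  set u : ℂ := (R n (m + 2) : ℂ)
  set s : ℂ := (R (n + 2) (m + 2) : ℂ)
  set p : ℂ := (R n m : ℂ)
  set E := e n (m + 1)
  set E' := e (n + 1) (m + 2)
  set F := e (n + 1) m
  set F' := e (n + 2) (m + 1)
  set X' : ℂ := (E'.re : ℂ)
  set Y : ℂ := (E.im : ℂ)
  have hq' : q ≠ 0 := by simpa [q] using hq.ne'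
  have c : 2 * Complex.I * q * E' ≠ 0 := by simp [hq', hE', Complex.I_ne_zero]
  have r1 : F' * E * ((q + s * Complex.I) * (u + q * Complex.I)) =
      E' ^ 2 * ((s + q * Complex.I) * (q + u * Complex.I)) := by
    linear_combination E * (u + q * Complex.I) * hse' - E' * (s + q * Complex.I) * hne
  have r2 : F * ((u + q * Complex.I) * (p + q * Complex.I)) =
      E' * ((q + u * Complex.I) * (q + p * Complex.I)) := by
    linear_combination (u + q * Complex.I) * hse - (q + p * Complex.I) * hne
  have r3 : E * (2 * Complex.I * V) = E' * (q + u * Complex.I) *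
      (X' * (s + q * Complex.I) + Complex.I * Y * (q + p * Complex.I)) := by
    rw [key, hne]; ring
  apply mul_right_cancel₀ c
  linear_combination ((E' + F) * (F' + E) * q * E') * r3 - q * F' * E * (E' + F) * a -
    q * Complex.I * E' * F * (F' + E) * b - q * X' * (E' + F) * (F' + E) * r1 -
    q * Complex.I * E' * Y * (E' + F) * (F' + E) * r2

end Pattern
end DiscreteConformal

/-! ### Verification of the equations for z² and the dual logarithm. -/

namespace DiscreteConformal

/-- Two edges of the quadrilateral carry a factor i, and i² = -1; the radii and directions on both
sides agree. -/
theorem KiteMap.crossRatio {f : ℕ → ℕ → ℂ} {ρ : ℕ → ℕ → ℝ} {ε : ℕ → ℕ → ℂ} (K : KiteMap f ρ ε)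
    {n m : ℕ} (h0 : (n, m) ≠ (0, 0)) :
    (f n m - f (n + 1) m) * (f (n + 1) (m + 1) - f n (m + 1)) =
      -((f (n + 1) m - f (n + 1) (m + 1)) * (f n (m + 1) - f n m)) := by
  rcases Nat.even_or_odd (n + m) with h | h
  · have o1 : Odd (n + (m + 1)) := by rw [Nat.even_iff] at *; rw [Nat.odd_iff]; omega
    have o2 : Odd (n + 1 + m) := by rw [Nat.even_iff] at *; rw [Nat.odd_iff]; omega
    have h1 := K.hor_even n m h h0
    have h2 := K.hor_odd n (m + 1) o1
    have h3 := K.ver_even n m h h0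
    have h4 := K.ver_odd (n + 1) m o2
    rw [← neg_sub, h1, h2, ← neg_sub (f (n + 1) (m + 1)), h4, h3]
    linear_combination -(ε (n + 1) m * ρ n m * ε n (m + 1) * ρ (n + 1) (m + 1)) * Complex.I_sq
  · have o1 : Even (n + (m + 1)) := by rw [Nat.odd_iff] at *; rw [Nat.even_iff]; omega
    have o2 : Even (n + 1 + m) := by rw [Nat.odd_iff] at *; rw [Nat.even_iff]; omega
    have h1 := K.hor_odd n m h
    have h2 := K.hor_even n (m + 1) o1 (by simp)
    have h3 := K.ver_odd n m h
    have h4 := K.ver_even (n + 1) m o2 (by simp)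
    rw [← neg_sub, h1, h2, ← neg_sub (f (n + 1) (m + 1)), h4, h3]
    linear_combination
      -(ε n m * ρ (n + 1) m * ε (n + 1) (m + 1) * ρ n (m + 1)) * Complex.I_sq

/-- A closed discrete one-form on the quadrant is exact. -/
theorem exists_potential {h v : ℕ → ℕ → ℂ}
    (closed : ∀ n m, h n m + v (n + 1) m = v n m + h n (m + 1)) :
    ∃ f : ℕ → ℕ → ℂ, f 0 0 = 0 ∧ (∀ n m, f (n + 1) m - f n m = h n m) ∧
      ∀ n m, f n (m + 1) - f n m = v n m := by
  let f : ℕ → ℕ → ℂ := fun n m => ∑ i ∈ Finset.range n, h i 0 + ∑ j ∈ Finset.range m, v n j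
  have hv : ∀ n m, f n (m + 1) - f n m = v n m := fun n m => by
    simp only [f, Finset.sum_range_succ]; ring
  refine ⟨f, by simp [f], fun n m => ?_, hv⟩
  induction m with
  | zero => simp [f, Finset.sum_range_succ]
  | succ m ih => linear_combination ih + hv (n + 1) m - hv n m + closed n m

namespace Pattern

variable {R : ℕ → ℕ → ℝ} {e : ℕ → ℕ → ℂ}

theorem radius_two_zero (P : Pattern R e) : R 2 0 = 1 := by simpa using P.radius_hor 1

theorem radius_zero_two (P : Pattern R e) : R 0 2 = 1 := by simpa using P.radius_ver 1

theorem z2_zero_zero (P : Pattern R e) : z2 R e 0 0 = 0 := by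
  have h := P.radius_two_zero
  simp [z2, z2Odd, P.axis_hor odd_one, P.origin, h]

theorem z2_one_zero (P : Pattern R e) : z2 R e 1 0 = 0 := by
  have h := z2_hor_even (R := R) (e := e) (n := 0) (m := 0) (by simp)
  simpa [P.z2_zero_zero, P.origin] using h

theorem z2_zero_one (P : Pattern R e) : z2 R e 0 1 = 0 := by
  have h := P.z2_ver_even (n := 0) (m := 0) (by simp)
  simpa [P.z2_zero_zero, P.origin] using h

theorem z2_axis_hor (P : Pattern R e) (n : ℕ) :
    2 * z2 R e (n + 1) 0 * (z2 R e (n + 2) 0 - z2 R e n 0) =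
      2 * ((n + 1 : ℕ) : ℂ) * (z2 R e (n + 2) 0 - z2 R e (n + 1) 0) *
        (z2 R e (n + 1) 0 - z2 R e n 0) := by
  rcases Nat.even_or_odd n with h | h
  · have o : Odd (n + 1 + 0) := by simpa using h.add_one
    have h1 : z2 R e (n + 2) 0 - z2 R e (n + 1) 0 = _ := P.z2_hor_odd o
    have h2 := z2_hor_even (R := R) (e := e) (n := n) (m := 0) (by simpa using h)
    have hor := P.hor n 0 o
    have val : z2 R e (n + 1) 0 = (z2Odd R e (n + 1) 0) := by rw [z2, if_pos o]
    have hE : e (n + 1) 0 = 1 := P.axis_hor o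
    rw [show z2 R e (n + 2) 0 - z2 R e n 0 = (z2 R e (n + 2) 0 - z2 R e (n + 1) 0) +
      (z2 R e (n + 1) 0 - z2 R e n 0) by ring, h1, h2, val, z2Odd, hE]
    rw [hE] at hor
    have hor' : (R (n + 2) 0 + R n 0 : ℂ) = n + 1 := by
      exact_mod_cast congrArg (fun x : ℝ => (x : ℂ)) (by simpa using hor)
    simp only [Complex.one_re, Complex.one_im]
    push_cast
    rw [show R (n + 1 + 1) 0 = R (n + 2) 0 from rfl, ← hor']
    ring
  · obtain ⟨k, rfl⟩ := h
    have o1 : Odd (2 * k + 1 + 0) := ⟨k, by ring⟩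
    have o2 : Odd (2 * k + 3 + 0) := ⟨k + 1, by ring⟩
    have h1 : z2 R e (2 * k + 3) 0 - z2 R e (2 * k + 2) 0 = e (2 * k + 3) 0 * R (2 * k + 2) 0 :=
      z2_hor_even ⟨k + 1, by ring⟩
    have h2 : z2 R e (2 * k + 2) 0 - z2 R e (2 * k + 1) 0 = _ := P.z2_hor_odd o1
    have val : z2 R e (2 * k + 1) 0 = (z2Odd R e (2 * k + 1) 0) := by rw [z2, if_pos o1]
    have hE : e (2 * k + 1) 0 = 1 := P.axis_hor o1
    have hE' : e (2 * k + 3) 0 = 1 := P.axis_hor o2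
    have hR : R (2 * k + 2) 0 = ((k + 1 : ℕ) : ℝ) := P.radius_hor (k + 1)
    show 2 * z2 R e (2 * k + 2) 0 * (z2 R e (2 * k + 3) 0 - z2 R e (2 * k + 1) 0) =
      2 * ((2 * k + 1 + 1 : ℕ) : ℂ) * (z2 R e (2 * k + 3) 0 - z2 R e (2 * k + 2) 0) *
        (z2 R e (2 * k + 2) 0 - z2 R e (2 * k + 1) 0)
    rw [sub_eq_iff_eq_add] at h1 h2
    rw [h1, h2, val, z2Odd, hE, hE',
      show 2 * k + 1 + 1 = 2 * k + 2 from rfl, hR]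
    simp only [Complex.one_re, Complex.one_im]
    push_cast
    ring

theorem z2_axis_ver (P : Pattern R e) (m : ℕ) :
    2 * z2 R e 0 (m + 1) * (z2 R e 0 (m + 2) - z2 R e 0 m) =
      2 * ((m + 1 : ℕ) : ℂ) * (z2 R e 0 (m + 2) - z2 R e 0 (m + 1)) *
        (z2 R e 0 (m + 1) - z2 R e 0 m) := by
  rcases Nat.even_or_odd m with h | h
  · have o : Odd (0 + (m + 1)) := by simpa using h.add_one
    have h1 : z2 R e 0 (m + 2) - z2 R e 0 (m + 1) = _ := P.z2_ver_odd o
    have h2 := P.z2_ver_even (n := 0) (m := m) (by simpa using h)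
    have ver := P.ver 0 m o
    have val : z2 R e 0 (m + 1) = (z2Odd R e 0 (m + 1)) := by rw [z2, if_pos o]
    have hE : e 0 (m + 1) = Complex.I := P.axis_ver (by simpa using o)
    rw [show z2 R e 0 (m + 2) - z2 R e 0 m = (z2 R e 0 (m + 2) - z2 R e 0 (m + 1)) +
      (z2 R e 0 (m + 1) - z2 R e 0 m) by ring, h1, h2, val, z2Odd, hE]
    rw [hE] at ver
    have ver' : (R 0 (m + 2) + R 0 m : ℂ) = m + 1 := by
      exact_mod_cast congrArg (fun x : ℝ => (x : ℂ)) (by simpa using ver)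
    simp only [Complex.I_re, Complex.I_im]
    push_cast
    rw [show R 0 (m + 1 + 1) = R 0 (m + 2) from rfl, ← ver']
    ring
  · obtain ⟨k, rfl⟩ := h
    have o1 : Odd (0 + (2 * k + 1)) := ⟨k, by ring⟩
    have o2 : Odd (0 + (2 * k + 3)) := ⟨k + 1, by ring⟩
    have h1 : z2 R e 0 (2 * k + 3) - z2 R e 0 (2 * k + 2) =
        Complex.I * e 0 (2 * k + 3) * R 0 (2 * k + 2) :=
      P.z2_ver_even ⟨k + 1, by ring⟩
    have h2 : z2 R e 0 (2 * k + 2) - z2 R e 0 (2 * k + 1) = _ := P.z2_ver_odd o1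
    have val : z2 R e 0 (2 * k + 1) = (z2Odd R e 0 (2 * k + 1)) := by rw [z2, if_pos o1]
    have hE : e 0 (2 * k + 1) = Complex.I := P.axis_ver (by simp)
    have hE' : e 0 (2 * k + 3) = Complex.I := P.axis_ver (by simpa using o2)
    have hR : R 0 (2 * k + 2) = ((k + 1 : ℕ) : ℝ) := P.radius_ver (k + 1)
    show 2 * z2 R e 0 (2 * k + 2) * (z2 R e 0 (2 * k + 3) - z2 R e 0 (2 * k + 1)) =
      2 * ((2 * k + 1 + 1 : ℕ) : ℂ) * (z2 R e 0 (2 * k + 3) - z2 R e 0 (2 * k + 2)) *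
        (z2 R e 0 (2 * k + 2) - z2 R e 0 (2 * k + 1))
    rw [sub_eq_iff_eq_add] at h1 h2
    rw [h1, h2, val, z2Odd, hE, hE',
      show 2 * k + 1 + 1 = 2 * k + 2 from rfl, hR]
    simp only [Complex.I_re, Complex.I_im]
    push_cast
    ring

theorem z2_inner (P : Pattern R e) (n m : ℕ) :
    2 * z2 R e (n + 1) (m + 1) * (z2 R e (n + 2) (m + 1) - z2 R e n (m + 1)) *
        (z2 R e (n + 1) (m + 2) - z2 R e (n + 1) m) =
      2 * ((n + 1 : ℕ) : ℂ) * (z2 R e (n + 2) (m + 1) - z2 R e (n + 1) (m + 1)) *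
          (z2 R e (n + 1) (m + 1) - z2 R e n (m + 1)) *
          (z2 R e (n + 1) (m + 2) - z2 R e (n + 1) m) +
        2 * ((m + 1 : ℕ) : ℂ) * (z2 R e (n + 1) (m + 2) - z2 R e (n + 1) (m + 1)) *
          (z2 R e (n + 1) (m + 1) - z2 R e (n + 1) m) *
          (z2 R e (n + 2) (m + 1) - z2 R e n (m + 1)) := by
  rw [show z2 R e (n + 2) (m + 1) - z2 R e n (m + 1) =
      (z2 R e (n + 2) (m + 1) - z2 R e (n + 1) (m + 1)) +
      (z2 R e (n + 1) (m + 1) - z2 R e n (m + 1)) by ring,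
    show z2 R e (n + 1) (m + 2) - z2 R e (n + 1) m =
      (z2 R e (n + 1) (m + 2) - z2 R e (n + 1) (m + 1)) +
      (z2 R e (n + 1) (m + 1) - z2 R e (n + 1) m) by ring]
  rcases Nat.even_or_odd (n + m) with h | h
  · have o1 : Odd (n + (m + 1)) := by rw [Nat.even_iff] at *; rw [Nat.odd_iff]; omega
    have o2 : Odd (n + 1 + m) := by rw [Nat.even_iff] at *; rw [Nat.odd_iff]; omega
    have ev : Even (n + 1 + (m + 1)) := by rw [Nat.even_iff] at *; omega
    have h1 : z2 R e (n + 2) (m + 1) - z2 R e (n + 1) (m + 1) =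
      e (n + 2) (m + 1) * R (n + 1) (m + 1) := z2_hor_even ev
    have h2 : z2 R e (n + 1) (m + 2) - z2 R e (n + 1) (m + 1) =
      Complex.I * e (n + 1) (m + 2) * R (n + 1) (m + 1) := P.z2_ver_even ev
    rw [h1, h2, P.z2_hor_odd o1, P.z2_ver_odd o2]
    linear_combination 2 * Complex.I * R (n + 1) (m + 1) ^ 2 * P.z2_center h
  · have o : Odd (n + 1 + (m + 1)) := by rw [Nat.odd_iff] at *; omega
    have ev1 : Even (n + (m + 1)) := by rw [Nat.odd_iff] at *; rw [Nat.even_iff]; omega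
    have ev2 : Even (n + 1 + m) := by rw [Nat.odd_iff] at *; rw [Nat.even_iff]; omega
    have h1 : z2 R e (n + 2) (m + 1) - z2 R e (n + 1) (m + 1) =
      e (n + 1) (m + 1) * R (n + 2) (m + 1) := P.z2_hor_odd o
    have h2 : z2 R e (n + 1) (m + 2) - z2 R e (n + 1) (m + 1) =
      Complex.I * e (n + 1) (m + 1) * R (n + 1) (m + 2) := P.z2_ver_odd o
    have hor := P.hor n (m + 1) o
    have ver := P.ver (n + 1) m o
    have hor' : (e (n + 1) (m + 1)).re * (R (n + 2) (m + 1) + R n (m + 1) : ℂ) =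
      ((n + 1 : ℕ) : ℂ) := by exact_mod_cast congrArg (fun x : ℝ => (x : ℂ)) hor
    have ver' : (e (n + 1) (m + 1)).im * (R (n + 1) (m + 2) + R (n + 1) m : ℂ) =
      ((m + 1 : ℕ) : ℂ) := by exact_mod_cast congrArg (fun x : ℝ => (x : ℂ)) ver
    rw [h1, h2, z2_hor_even ev1, P.z2_ver_even ev2, z2, if_pos o, z2Odd,
      show R (n + 1 + 1) (m + 1) = R (n + 2) (m + 1) from rfl,
      show R (n + 1) (m + 1 + 1) = R (n + 1) (m + 2) from rfl, ← hor', ← ver']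
    ring

theorem isZ2 (P : Pattern R e) : IsZ2 (z2 R e) where
  crossRatio n m := by
    by_cases h : (n, m) = (0, 0)
    · simp only [Prod.mk.injEq] at h
      obtain ⟨rfl, rfl⟩ := h
      simp [P.z2_zero_zero, P.z2_one_zero, P.z2_zero_one]
    · exact P.kiteMap_z2.crossRatio h
  constraint :=
    { origin := by rw [P.z2_zero_zero, mul_zero]
      horizontal := P.z2_axis_hor
      vertical := P.z2_axis_ver
      inner := P.z2_inner }
  init00 := P.z2_zero_zero
  init10 := P.z2_one_zero
  init01 := P.z2_zero_one
  init20 := by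
    have h := P.z2_hor_odd (n := 1) (m := 0) (by simp)
    simpa [P.z2_one_zero, P.axis_hor odd_one, P.radius_two_zero] using h
  init02 := by
    have h := P.z2_ver_odd (n := 0) (m := 1) (by simp)
    simpa [P.z2_zero_one, P.axis_ver odd_one, P.radius_zero_two] using h
  init11 := by
    have h := P.z2_ver_odd (n := 1) (m := 0) (by simp)
    simpa [P.z2_one_zero, P.axis_hor odd_one, P.radius_one_one] using h

/-- The one-form with edges 1/(e R) is closed because inverting R and e preserves the closing
conditions. The potential has a finite value at the origin without meaning, later replaced by ∞. -/
theorem exists_log (P : Pattern R e) : ∃ g : ℕ → ℕ → ℂ,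
    KiteMap g (fun n m => (R n m)⁻¹) (fun n m => (e n m)⁻¹) ∧
      g 1 0 = 0 ∧ g 0 1 = Complex.I * Real.pi := by
  let h : ℕ → ℕ → ℂ := fun n m =>
    if Odd (n + m) then (e n m)⁻¹ * (R (n + 1) m : ℂ)⁻¹ else (e (n + 1) m)⁻¹ * (R n m : ℂ)⁻¹
  -- At the origin the inverse radius is 0 by convention, so the first horizontal edge is 0. The
  -- first vertical edge must then be iπ for the cell to close, since R(1,1) = 2/π.
  let v : ℕ → ℕ → ℂ := fun n m => if (n, m) = (0, 0) then Complex.I * Real.pi else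
    if Odd (n + m) then Complex.I * (e n m)⁻¹ * (R n (m + 1) : ℂ)⁻¹ else
      Complex.I * (e n (m + 1))⁻¹ * (R n m : ℂ)⁻¹
  have closed : ∀ n m, h n m + v (n + 1) m = v n m + h n (m + 1) := by
    intro n m
    by_cases h0 : (n, m) = (0, 0)
    · simp only [Prod.mk.injEq] at h0
      obtain ⟨rfl, rfl⟩ := h0
      have := Real.pi_pos.ne'
      simp [h, v, P.origin, P.radius_one_one, P.axis_hor odd_one, P.axis_ver odd_one]
      ring
    · have v1 : (n + 1, m) ≠ (0, 0) := by simp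
      rcases Nat.even_or_odd (n + m) with hp | hp
      · have o0 : ¬ Odd (n + m) := Nat.not_odd_iff_even.2 hp
        have o1 : Odd (n + (m + 1)) := by rw [Nat.even_iff] at *; rw [Nat.odd_iff]; omega
        have o2 : Odd (n + 1 + m) := by rw [Nat.even_iff] at *; rw [Nat.odd_iff]; omega
        simp only [h, v, if_neg o0, if_pos o1, if_pos o2, if_neg h0, if_neg v1]
        have c1 : (R n m : ℂ) ≠ 0 := by exact_mod_cast (P.pos n m hp h0).ne'
        have c2 : (R (n + 1) (m + 1) : ℂ) ≠ 0 := by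
          exact_mod_cast (P.pos (n + 1) (m + 1) (by rw [Nat.even_iff] at *; omega) (by simp)).ne'
        have c3 := P.ne_zero o1
        have c4 := P.ne_zero o2
        field_simp
        linear_combination -P.se n m hp
      · have o1 : ¬ Odd (n + (m + 1)) := by rw [Nat.odd_iff] at *; omega
        have o2 : ¬ Odd (n + 1 + m) := by rw [Nat.odd_iff] at *; omega
        have o3 : Odd (n + 1 + (m + 1)) := by rw [Nat.odd_iff] at *; omega
        simp only [h, v, if_pos hp, if_neg o1, if_neg o2, if_neg h0, if_neg v1]
        have c1 : (R (n + 1) m : ℂ) ≠ 0 := by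
          exact_mod_cast (P.pos _ _ (Nat.not_odd_iff_even.1 o2) (by simp)).ne'
        have c2 : (R n (m + 1) : ℂ) ≠ 0 := by
          exact_mod_cast (P.pos _ _ (Nat.not_odd_iff_even.1 o1) (by simp)).ne'
        have c3 := P.ne_zero hp
        have c4 := P.ne_zero o3
        field_simp
        linear_combination -Complex.I * P.ne n m hp +
          (R n (m + 1) * e (n + 1) (m + 1) - R (n + 1) m * e n m) * Complex.I_sq
  obtain ⟨g, g0, gh, gv⟩ := exists_potential closed
  refine ⟨g, ⟨fun n m hp h0 => inv_pos.2 (P.pos n m hp h0), fun n m hp => ?_, fun n m hp => ?_,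
    fun n m hp h0 => ?_, fun n m hp => ?_, fun n m hp h0 => ?_⟩, ?_, ?_⟩
  · rw [norm_inv, P.norm_eq hp, inv_one]
  · simp [gh, h, hp]
  · simp [gh, h, Nat.not_odd_iff_even.2 hp]
  · have h0 : (n, m) ≠ (0, 0) := by
      rintro hc
      simp only [Prod.mk.injEq] at hc
      simp [hc.1, hc.2] at hp
    simp [gv, v, hp, -Prod.mk.injEq, h0]
  · simp [gv, v, -Prod.mk.injEq, Nat.not_odd_iff_even.2 hp, h0]
  · have := gh 0 0
    simpa [g0, h, P.origin] using this
  · have := gv 0 0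
    simpa [g0, v] using this

end Pattern

/-- A map that is infinite at the origin and finite elsewhere. -/
def infAtOrigin (g : ℕ → ℕ → ℂ) (n m : ℕ) : OnePoint ℂ :=
  if (n, m) = (0, 0) then OnePoint.infty else (g n m : OnePoint ℂ)

theorem infAtOrigin_zero (g : ℕ → ℕ → ℂ) : infAtOrigin g 0 0 = OnePoint.infty := rfl

theorem infAtOrigin_of_ne (g : ℕ → ℕ → ℂ) {n m : ℕ} (h : (n, m) ≠ (0, 0)) :
    infAtOrigin g n m = (g n m : OnePoint ℂ) := if_neg h

theorem infAtOrigin_succ_left (g : ℕ → ℕ → ℂ) (n m : ℕ) :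
    infAtOrigin g (n + 1) m = (g (n + 1) m : OnePoint ℂ) := infAtOrigin_of_ne g (by simp)

theorem infAtOrigin_succ_right (g : ℕ → ℕ → ℂ) (n m : ℕ) :
    infAtOrigin g n (m + 1) = (g n (m + 1) : OnePoint ℂ) := infAtOrigin_of_ne g (by simp)

theorem den_coe (z : ℂ) : den (z : OnePoint ℂ) = 1 := rfl

theorem hdiff_infty_coe (z : ℂ) : hdiff OnePoint.infty (z : OnePoint ℂ) = 1 := by
  simp [hdiff, num, den]

theorem hdiff_coe_infty (z : ℂ) : hdiff (z : OnePoint ℂ) OnePoint.infty = -1 := by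
  simp [hdiff, num, den]

namespace Pattern

variable {R : ℕ → ℕ → ℝ} {e : ℕ → ℕ → ℂ} {g : ℕ → ℕ → ℂ}

theorem log_two_zero (P : Pattern R e)
    (K : KiteMap g (fun n m => (R n m)⁻¹) (fun n m => (e n m)⁻¹)) : g 2 0 = g 1 0 + 1 := by
  have := K.hor_odd 1 0 (by simp)
  rw [sub_eq_iff_eq_add] at this
  rw [this]
  simp [P.axis_hor odd_one, P.radius_two_zero, add_comm]

theorem log_zero_two (P : Pattern R e)
    (K : KiteMap g (fun n m => (R n m)⁻¹) (fun n m => (e n m)⁻¹)) : g 0 2 = g 0 1 + 1 := by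
  have := K.ver_odd 0 1 (by simp)
  rw [sub_eq_iff_eq_add] at this
  rw [this]
  simp [P.axis_ver odd_one, P.radius_zero_two, add_comm]

theorem log_one_one (P : Pattern R e)
    (K : KiteMap g (fun n m => (R n m)⁻¹) (fun n m => (e n m)⁻¹)) :
    g 1 1 = g 1 0 + Complex.I * (Real.pi / 2) := by
  have := K.ver_odd 1 0 (by simp)
  rw [sub_eq_iff_eq_add] at this
  rw [this]
  simp [P.axis_hor odd_one, P.radius_one_one, add_comm]

theorem log_axis_hor (P : Pattern R e)
    (K : KiteMap g (fun n m => (R n m)⁻¹) (fun n m => (e n m)⁻¹)) (n : ℕ) :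
    g (n + 3) 0 - g (n + 1) 0 =
      ((n + 2 : ℕ) : ℂ) * (g (n + 3) 0 - g (n + 2) 0) * (g (n + 2) 0 - g (n + 1) 0) := by
  rw [show g (n + 3) 0 - g (n + 1) 0 = (g (n + 3) 0 - g (n + 2) 0) + (g (n + 2) 0 - g (n + 1) 0)
    by ring]
  rcases Nat.even_or_odd n with h | h
  · obtain ⟨k, rfl⟩ := even_iff_exists_two_mul.1 h
    have o1 : Odd (2 * k + 1 + 0) := ⟨k, by ring⟩
    have o2 : Odd (2 * k + 3 + 0) := ⟨k + 1, by ring⟩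
    have h1 : g (2 * k + 3) 0 - g (2 * k + 2) 0 = _ :=
      K.hor_even (2 * k + 2) 0 ⟨k + 1, by ring⟩ (by simp)
    have h2 : g (2 * k + 2) 0 - g (2 * k + 1) 0 = _ := K.hor_odd (2 * k + 1) 0 o1
    have hE : e (2 * k + 1) 0 = 1 := P.axis_hor o1
    have hE' : e (2 * k + 3) 0 = 1 := P.axis_hor o2
    have hR : R (2 * k + 2) 0 = ((k + 1 : ℕ) : ℝ) := P.radius_hor (k + 1)
    rw [h1, h2, show 2 * k + 1 + 1 = 2 * k + 2 from rfl, hE, hR,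
      show 2 * k + 2 + 1 = 2 * k + 3 from rfl, hE']
    have : (k : ℂ) + 1 ≠ 0 := Nat.cast_add_one_ne_zero k
    push_cast
    field_simp
    ring
  · have o : Odd (n + 2 + 0) := by rw [Nat.odd_iff] at *; omega
    have h1 : g (n + 3) 0 - g (n + 2) 0 = _ := K.hor_odd (n + 2) 0 o
    have h2 : g (n + 2) 0 - g (n + 1) 0 = _ :=
      K.hor_even (n + 1) 0 (by rw [Nat.odd_iff] at *; rw [Nat.even_iff]; omega) (by simp)
    have hor := P.hor (n + 1) 0 o
    have hE : e (n + 2) 0 = 1 := P.axis_hor o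
    have c1 : (R (n + 3) 0 : ℂ) ≠ 0 := by
      exact_mod_cast (P.pos (n + 3) 0 (by rw [Nat.odd_iff] at *; rw [Nat.even_iff]; omega)
        (by simp)).ne'
    have c2 : (R (n + 1) 0 : ℂ) ≠ 0 := by
      exact_mod_cast (P.pos (n + 1) 0 (by rw [Nat.odd_iff] at *; rw [Nat.even_iff]; omega)
        (by simp)).ne'
    rw [show n + 1 + 1 = n + 2 from rfl, hE] at hor
    have hor' : (R (n + 3) 0 + R (n + 1) 0 : ℂ) = n + 2 := by
      have : R (n + 3) 0 + R (n + 1) 0 = (n : ℝ) + 2 := by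
        simp only [Complex.one_re] at hor
        push_cast at hor
        linear_combination hor
      exact_mod_cast congrArg (fun x : ℝ => (x : ℂ)) this
    rw [h1, h2, show n + 1 + 1 = n + 2 from rfl, hE, show n + 2 + 1 = n + 3 from rfl]
    push_cast
    field_simp
    linear_combination hor'

theorem log_axis_ver (P : Pattern R e)
    (K : KiteMap g (fun n m => (R n m)⁻¹) (fun n m => (e n m)⁻¹)) (m : ℕ) :
    g 0 (m + 3) - g 0 (m + 1) =
      ((m + 2 : ℕ) : ℂ) * (g 0 (m + 3) - g 0 (m + 2)) * (g 0 (m + 2) - g 0 (m + 1)) := by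
  have hI : Complex.I * Complex.I⁻¹ = 1 := mul_inv_cancel₀ Complex.I_ne_zero
  rw [show g 0 (m + 3) - g 0 (m + 1) = (g 0 (m + 3) - g 0 (m + 2)) + (g 0 (m + 2) - g 0 (m + 1))
    by ring]
  rcases Nat.even_or_odd m with h | h
  · obtain ⟨k, rfl⟩ := even_iff_exists_two_mul.1 h
    have o1 : Odd (0 + (2 * k + 1)) := ⟨k, by ring⟩
    have o2 : Odd (0 + (2 * k + 3)) := ⟨k + 1, by ring⟩
    have h1 : g 0 (2 * k + 3) - g 0 (2 * k + 2) = _ :=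
      K.ver_even 0 (2 * k + 2) ⟨k + 1, by ring⟩ (by simp)
    have h2 : g 0 (2 * k + 2) - g 0 (2 * k + 1) = _ := K.ver_odd 0 (2 * k + 1) o1
    have hE : e 0 (2 * k + 1) = Complex.I := P.axis_ver (by simp)
    have hE' : e 0 (2 * k + 3) = Complex.I := P.axis_ver (by simpa using o2)
    have hR : R 0 (2 * k + 2) = ((k + 1 : ℕ) : ℝ) := P.radius_ver (k + 1)
    rw [h1, h2, show 2 * k + 1 + 1 = 2 * k + 2 from rfl, hE, hR,
      show 2 * k + 2 + 1 = 2 * k + 3 from rfl, hE', hI]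
    have : (k : ℂ) + 1 ≠ 0 := Nat.cast_add_one_ne_zero k
    push_cast
    field_simp
    ring
  · have o : Odd (0 + (m + 2)) := by rw [Nat.odd_iff] at *; omega
    have h1 : g 0 (m + 3) - g 0 (m + 2) = _ := K.ver_odd 0 (m + 2) o
    have h2 : g 0 (m + 2) - g 0 (m + 1) = _ :=
      K.ver_even 0 (m + 1) (by rw [Nat.odd_iff] at *; rw [Nat.even_iff]; omega) (by simp)
    have ver := P.ver 0 (m + 1) o
    have hE : e 0 (m + 2) = Complex.I := P.axis_ver (by simpa using o)
    have c1 : (R 0 (m + 3) : ℂ) ≠ 0 := by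
      exact_mod_cast (P.pos 0 (m + 3) (by rw [Nat.odd_iff] at *; rw [Nat.even_iff]; omega)
        (by simp)).ne'
    have c2 : (R 0 (m + 1) : ℂ) ≠ 0 := by
      exact_mod_cast (P.pos 0 (m + 1) (by rw [Nat.odd_iff] at *; rw [Nat.even_iff]; omega)
        (by simp)).ne'
    rw [show m + 1 + 1 = m + 2 from rfl, hE] at ver
    have ver' : (R 0 (m + 3) + R 0 (m + 1) : ℂ) = m + 2 := by
      have : R 0 (m + 3) + R 0 (m + 1) = (m : ℝ) + 2 := by
        simp only [Complex.I_im] at ver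
        push_cast at ver
        linear_combination ver
      exact_mod_cast congrArg (fun x : ℝ => (x : ℂ)) this
    rw [h1, h2, show m + 1 + 1 = m + 2 from rfl, hE, show m + 2 + 1 = m + 3 from rfl, hI]
    push_cast
    field_simp
    linear_combination ver'

theorem log_inner (P : Pattern R e)
    (K : KiteMap g (fun n m => (R n m)⁻¹) (fun n m => (e n m)⁻¹)) (n m : ℕ) :
    (g (n + 2) (m + 1) - g n (m + 1)) * (g (n + 1) (m + 2) - g (n + 1) m) =
      ((n + 1 : ℕ) : ℂ) * (g (n + 2) (m + 1) - g (n + 1) (m + 1)) *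
          (g (n + 1) (m + 1) - g n (m + 1)) * (g (n + 1) (m + 2) - g (n + 1) m) +
        ((m + 1 : ℕ) : ℂ) * (g (n + 1) (m + 2) - g (n + 1) (m + 1)) *
          (g (n + 1) (m + 1) - g (n + 1) m) * (g (n + 2) (m + 1) - g n (m + 1)) := by
  rw [show g (n + 2) (m + 1) - g n (m + 1) = (g (n + 2) (m + 1) - g (n + 1) (m + 1)) +
      (g (n + 1) (m + 1) - g n (m + 1)) by ring,
    show g (n + 1) (m + 2) - g (n + 1) m = (g (n + 1) (m + 2) - g (n + 1) (m + 1)) +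
      (g (n + 1) (m + 1) - g (n + 1) m) by ring]
  rcases Nat.even_or_odd (n + m) with h | h
  · have o1 : Odd (n + (m + 1)) := by rw [Nat.even_iff] at *; rw [Nat.odd_iff]; omega
    have o2 : Odd (n + 1 + m) := by rw [Nat.even_iff] at *; rw [Nat.odd_iff]; omega
    have o3 : Odd (n + 2 + (m + 1)) := by rw [Nat.even_iff] at *; rw [Nat.odd_iff]; omega
    have o4 : Odd (n + 1 + (m + 2)) := by rw [Nat.even_iff] at *; rw [Nat.odd_iff]; omega
    have ev : Even (n + 1 + (m + 1)) := by rw [Nat.even_iff] at *; omega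
    have h1 : g (n + 2) (m + 1) - g (n + 1) (m + 1) = _ :=
      K.hor_even (n + 1) (m + 1) ev (by simp)
    have h2 : g (n + 1) (m + 2) - g (n + 1) (m + 1) = _ :=
      K.ver_even (n + 1) (m + 1) ev (by simp)
    have c := P.log_center h
    have c0 : (R (n + 1) (m + 1) : ℂ) ≠ 0 := by exact_mod_cast (P.pos _ _ ev (by simp)).ne'
    have c1 := P.ne_zero o1
    have c2 := P.ne_zero o2
    have c3 := P.ne_zero o3
    have c4 := P.ne_zero o4
    rw [h1, h2, K.hor_odd n (m + 1) o1, K.ver_odd (n + 1) m o2]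
    simp only [Complex.ofReal_inv]
    rw [show n + 1 + 1 = n + 2 from rfl, show m + 1 + 1 = m + 2 from rfl]
    field_simp
    linear_combination -c
  · have o : Odd (n + 1 + (m + 1)) := by rw [Nat.odd_iff] at *; omega
    have ev1 : Even (n + (m + 1)) := by rw [Nat.odd_iff] at *; rw [Nat.even_iff]; omega
    have ev2 : Even (n + 1 + m) := by rw [Nat.odd_iff] at *; rw [Nat.even_iff]; omega
    have ev3 : Even (n + 2 + (m + 1)) := by rw [Nat.odd_iff] at *; rw [Nat.even_iff]; omega
    have ev4 : Even (n + 1 + (m + 2)) := by rw [Nat.odd_iff] at *; rw [Nat.even_iff]; omega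
    have h1 : g (n + 2) (m + 1) - g (n + 1) (m + 1) = _ := K.hor_odd (n + 1) (m + 1) o
    have h2 : g (n + 1) (m + 2) - g (n + 1) (m + 1) = _ := K.ver_odd (n + 1) (m + 1) o
    have hor := P.hor n (m + 1) o
    have ver := P.ver (n + 1) m o
    have hor' : (e (n + 1) (m + 1)).re * (R (n + 2) (m + 1) + R n (m + 1) : ℂ) =
      ((n + 1 : ℕ) : ℂ) := by exact_mod_cast congrArg (fun x : ℝ => (x : ℂ)) hor
    have ver' : (e (n + 1) (m + 1)).im * (R (n + 1) (m + 2) + R (n + 1) m : ℂ) =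
      ((m + 1 : ℕ) : ℂ) := by exact_mod_cast congrArg (fun x : ℝ => (x : ℂ)) ver
    have c1 : (R n (m + 1) : ℂ) ≠ 0 := by exact_mod_cast (P.pos _ _ ev1 (by simp)).ne'
    have c2 : (R (n + 1) m : ℂ) ≠ 0 := by exact_mod_cast (P.pos _ _ ev2 (by simp)).ne'
    have c3 : (R (n + 2) (m + 1) : ℂ) ≠ 0 := by exact_mod_cast (P.pos _ _ ev3 (by simp)).ne'
    have c4 : (R (n + 1) (m + 2) : ℂ) ≠ 0 := by exact_mod_cast (P.pos _ _ ev4 (by simp)).ne'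
    have c5 := P.ne_zero o
    -- The constraint at an intersection point is the decomposition of e into its real and imaginary
    -- parts.
    have split := Complex.re_add_im (e (n + 1) (m + 1))
    rw [h1, h2, K.hor_even n (m + 1) ev1 (by simp), K.ver_even (n + 1) m ev2 (by simp)]
    simp only [Complex.ofReal_inv]
    rw [show n + 1 + 1 = n + 2 from rfl, show m + 1 + 1 = m + 2 from rfl]
    field_simp
    linear_combination -(R n (m + 1) + R (n + 2) (m + 1) : ℂ) *
        (R (n + 1) m + R (n + 1) (m + 2)) * split +
      (R (n + 1) m + R (n + 1) (m + 2) : ℂ) * hor' +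
      (R n (m + 1) + R (n + 2) (m + 1) : ℂ) * Complex.I * ver'

theorem isLog (P : Pattern R e)
    (K : KiteMap g (fun n m => (R n m)⁻¹) (fun n m => (e n m)⁻¹)) (h10 : g 1 0 = 0)
    (h01 : g 0 1 = Complex.I * Real.pi) : IsLog (infAtOrigin g) where
  crossRatio n m := by
    by_cases h : (n, m) = (0, 0)
    · simp only [Prod.mk.injEq] at h
      obtain ⟨rfl, rfl⟩ := h
      rw [infAtOrigin_zero, infAtOrigin_succ_left, infAtOrigin_succ_left, infAtOrigin_succ_right,
        hdiff_infty_coe, hdiff_coe, hdiff_coe, hdiff_coe_infty]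
      simp only [zero_add, P.log_one_one K, h10, h01]
      ring
    · rw [infAtOrigin_of_ne g h, infAtOrigin_succ_left, infAtOrigin_succ_left,
        infAtOrigin_succ_right]
      simp only [hdiff_coe]
      exact K.crossRatio h
  constraint :=
    { horizontal := by
        rintro (_ | n)
        · simp [infAtOrigin_zero, infAtOrigin_succ_left, den_coe, hdiff_coe_infty, hdiff_coe,
            P.log_two_zero K]
        · simp only [infAtOrigin_succ_left, den_coe, hdiff_coe, one_pow, one_mul]
          exact P.log_axis_hor K n
      vertical := by
        rintro (_ | m)
        · simp [infAtOrigin_zero, infAtOrigin_succ_right, den_coe, hdiff_coe_infty, hdiff_coe,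
            P.log_zero_two K]
        · simp only [infAtOrigin_succ_right, den_coe, hdiff_coe, one_pow, one_mul]
          exact P.log_axis_ver K m
      inner := by
        intro n m
        simp only [infAtOrigin_succ_left, infAtOrigin_succ_right, den_coe, hdiff_coe, one_pow,
          one_mul]
        exact P.log_inner K n m }
  init00 := rfl
  init10 := by rw [infAtOrigin_of_ne g (by simp), h10]
  init01 := by rw [infAtOrigin_of_ne g (by simp), h01]
  init20 := by rw [infAtOrigin_of_ne g (by simp), P.log_two_zero K, h10, zero_add]
  init02 := by rw [infAtOrigin_of_ne g (by simp), P.log_zero_two K, h01, add_comm]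
  init11 := by rw [infAtOrigin_of_ne g (by simp), P.log_one_one K, h10, zero_add]

end Pattern
end DiscreteConformal

/-! ### Planar geometry: cones and kites. -/

namespace DiscreteConformal
open Filter Topology

/-- Twice the oriented area of the triangle spanned by `v` and `z`; its sign tells the side of the
line spanned by `v` on which `z` lies. -/
def side (v z : ℂ) : ℝ := v.re * z.im - v.im * z.re

/-- A common interior point stays in T when moved slightly in the direction iv, which makes `side`
strictly positive. -/
theorem disjoint_interior_of_side {S T : Set ℂ} {c v : ℂ} (hv : v ≠ 0)
    (hS : ∀ z ∈ S, 0 ≤ side v (z - c)) (hT : ∀ z ∈ T, side v (z - c) ≤ 0) :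
    Disjoint (interior S) (interior T) := by
  rw [Set.disjoint_left]
  intro z hz hz'
  have hc : ContinuousAt (fun t : ℝ => z + t * (Complex.I * v)) 0 := by fun_prop
  have h1 : ∀ᶠ t : ℝ in 𝓝 0, z + t * (Complex.I * v) ∈ interior T := by
    refine hc.eventually (isOpen_interior.mem_nhds ?_)
    simpa using hz'
  obtain ⟨t, ht, ht0⟩ :=
    ((h1.filter_mono nhdsWithin_le_nhds).and (self_mem_nhdsWithin (s := Set.Ioi (0 : ℝ)))).exists
  have h2 := hT _ (interior_subset ht)
  have h3 := hS _ (interior_subset hz)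
  have h4 : 0 < Complex.normSq v := Complex.normSq_pos.2 hv
  rw [Complex.normSq_apply] at h4
  have h5 := mul_pos (Set.mem_Ioi.1 ht0) h4
  simp [side] at h2 h3
  nlinarith

/-- The cone with apex `c` spanned by `v` and `w`. -/
def cone (c v w : ℂ) : Set ℂ := {z | ∃ x y : ℝ, 0 ≤ x ∧ 0 ≤ y ∧ z = c + x * v + y * w}

theorem convex_cone (c v w : ℂ) : Convex ℝ (cone c v w) := by
  rintro _ ⟨x, y, hx, hy, rfl⟩ _ ⟨x', y', hx', hy', rfl⟩ a b ha hb hab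
  refine ⟨a * x + b * x', a * y + b * y', by positivity, by positivity, ?_⟩
  have : (a : ℂ) + b = 1 := by exact_mod_cast congrArg (fun x : ℝ => (x : ℂ)) hab
  simp only [Complex.real_smul]
  push_cast
  linear_combination c * this

theorem apex_mem_cone (c v w : ℂ) : c ∈ cone c v w := ⟨0, 0, le_rfl, le_rfl, by simp⟩

theorem side_cone {c v w d z : ℂ} (hz : z ∈ cone c v w) :
    ∃ x y : ℝ, 0 ≤ x ∧ 0 ≤ y ∧ side d (z - c) = x * side d v + y * side d w := by
  obtain ⟨x, y, hx, hy, rfl⟩ := hz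
  refine ⟨x, y, hx, hy, ?_⟩
  simp [side]
  ring

theorem side_comm (v w : ℂ) : side v w = -side w v := by unfold side; ring

theorem side_self (v : ℂ) : side v v = 0 := by unfold side; ring

/-- Two cones with common apex, spanned by directions in cyclic order, have disjoint interiors. -/
theorem disjoint_interior_of_cones {S T : Set ℂ} {c v₁ v₂ v₃ v₄ : ℂ} (hS : S ⊆ cone c v₁ v₂)
    (hT : T ⊆ cone c v₃ v₄) (h1 : v₁ ≠ 0) (h3 : v₃ ≠ 0) (h12 : 0 ≤ side v₁ v₂)
    (h23 : 0 ≤ side v₂ v₃) (h34 : 0 ≤ side v₃ v₄) (h41 : 0 ≤ side v₄ v₁) :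
    Disjoint (interior S) (interior T) := by
  have s41 := side_comm v₁ v₄
  have s23 := side_comm v₃ v₂
  have s13 := side_comm v₃ v₁
  -- According to this sign, the line along v₁ or the line along v₃ separates the cones.
  rcases le_total (side v₁ v₃) 0 with h | h
  · refine disjoint_interior_of_side (c := c) h1 (fun z hz => ?_) (fun z hz => ?_)
    · obtain ⟨x, y, hx, hy, e⟩ := side_cone (d := v₁) (hS hz)
      rw [e, side_self]
      positivity
    · obtain ⟨x, y, hx, hy, e⟩ := side_cone (d := v₁) (hT hz)
      rw [e]
      nlinarith
  · refine (disjoint_interior_of_side (c := c) h3 (fun z hz => ?_) (fun z hz => ?_)).symm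
    · obtain ⟨x, y, hx, hy, e⟩ := side_cone (d := v₃) (hT hz)
      rw [e, side_self]
      positivity
    · obtain ⟨x, y, hx, hy, e⟩ := side_cone (d := v₃) (hS hz)
      rw [e]
      nlinarith

/-- A kite with vertices `w`, `A`, `w'`, `C` in positive cyclic order, with right angles at `w` and
`w'`. -/
structure IsKite (w A w' C v v' : ℂ) (q u : ℝ) : Prop where
  q_pos : 0 < q
  u_pos : 0 < u
  A_eq : A = w + v * q
  C_eq : C = w + Complex.I * v * u
  A_opp : w' = A + Complex.I * v' * q
  C_opp : w' = C + v' * u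

namespace IsKite

variable {w A w' C v v' : ℂ} {q u : ℝ}

/-- Relabeling the kite from its other right angle; it halves the number of cone inclusions to be
computed. -/
theorem symm (K : IsKite w A w' C v v' q u) : IsKite w' C w A (-v') (-v) u q where
  q_pos := K.u_pos
  u_pos := K.q_pos
  A_eq := by rw [K.C_opp]; ring
  C_eq := by rw [K.A_opp]; ring
  A_opp := by rw [K.C_eq]; ring
  C_opp := by rw [K.A_eq]; ring

theorem rotation (K : IsKite w A w' C v v' q u) :
    v' * (u - Complex.I * q) = v * (q - Complex.I * u) := by
  have := K.A_opp.symm.trans K.C_opp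
  rw [K.A_eq, K.C_eq] at this
  linear_combination -this

theorem arm_ne_zero (K : IsKite w A w' C v v' q u) : (u - Complex.I * q : ℂ) ≠ 0 := by
  intro h
  have := congrArg Complex.re h
  simp at this
  exact K.u_pos.ne' this

/-- The coordinates of w' are those of the mirror image of w in the axis AC. -/
theorem mem_cone_odd (K : IsKite w A w' C v v' q u) :
    w ∈ cone w v (Complex.I * v) ∧ A ∈ cone w v (Complex.I * v) ∧
      w' ∈ cone w v (Complex.I * v) ∧ C ∈ cone w v (Complex.I * v) := by
  have hq := K.q_pos
  have hu := K.u_pos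
  refine ⟨apex_mem_cone _ _ _, ⟨q, 0, hq.le, le_rfl, by rw [K.A_eq]; push_cast; ring⟩,
    ⟨2 * q * u ^ 2 / (q ^ 2 + u ^ 2), 2 * q ^ 2 * u / (q ^ 2 + u ^ 2), by positivity, by positivity,
      ?_⟩, ⟨0, u, le_rfl, hu.le, by rw [K.C_eq]; push_cast; ring⟩⟩
  have hD : (q ^ 2 + u ^ 2 : ℂ) ≠ 0 := by
    exact_mod_cast (by positivity : q ^ 2 + u ^ 2 ≠ 0)
  rw [K.A_opp, K.A_eq]
  apply mul_right_cancel₀ K.arm_ne_zero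
  push_cast
  field_simp
  linear_combination (Complex.I * q * (q ^ 2 + u ^ 2)) * K.rotation +
    v * q * u * (q ^ 2 - u ^ 2) * Complex.I_sq

/-- C lies on the bisector of the angle at A, hence its two coordinates are equal. -/
theorem mem_cone_even (K : IsKite w A w' C v v' q u) :
    w ∈ cone A (Complex.I * v') (-v) ∧ A ∈ cone A (Complex.I * v') (-v) ∧
      w' ∈ cone A (Complex.I * v') (-v) ∧ C ∈ cone A (Complex.I * v') (-v) := by
  have hq := K.q_pos
  have hu := K.u_pos
  refine ⟨⟨0, q, le_rfl, hq.le, by rw [K.A_eq]; push_cast; ring⟩, apex_mem_cone _ _ _,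
    ⟨q, 0, hq.le, le_rfl, by rw [K.A_opp]; push_cast; ring⟩,
    ⟨(q ^ 2 + u ^ 2) / (2 * q), (q ^ 2 + u ^ 2) / (2 * q), by positivity, by positivity, ?_⟩⟩
  have hq' : (q : ℂ) ≠ 0 := by exact_mod_cast hq.ne'
  rw [K.C_eq, K.A_eq]
  apply mul_right_cancel₀ K.arm_ne_zero
  push_cast
  field_simp
  linear_combination (-Complex.I * (q ^ 2 + u ^ 2)) * K.rotation +
    v * u * (u ^ 2 - q ^ 2) * Complex.I_sq

/-- The angle at A is 2 arctan(u/q), which is less than π, so its sine is positive. -/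
theorem side_nonneg (K : IsKite w A w' C v v' q u) : 0 ≤ side (Complex.I * v') (-v) := by
  have hq := K.q_pos
  have hu := K.u_pos
  have h := K.rotation
  have h1 := congrArg Complex.re h
  have h2 := congrArg Complex.im h
  simp at h1 h2
  have key : side (Complex.I * v') (-v) * (q ^ 2 + u ^ 2) = 2 * q * u * (v.re ^ 2 + v.im ^ 2) := by
    simp [side]
    linear_combination (v.re * u + v.im * q) * h1 + (v.im * u - v.re * q) * h2
  have h3 : 0 ≤ side (Complex.I * v') (-v) * (q ^ 2 + u ^ 2) := by rw [key]; positivity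
  exact nonneg_of_mul_nonneg_left h3 (by positivity)

end IsKite

/-- The convex hull of the vertices of an elementary quadrilateral. -/
def hull (f : ℕ → ℕ → ℂ) (n m : ℕ) : Set ℂ :=
  convexHull ℝ {f n m, f (n + 1) m, f (n + 1) (m + 1), f n (m + 1)}

theorem hull_subset {f : ℕ → ℕ → ℂ} {n m : ℕ} {K : Set ℂ} (hK : Convex ℝ K) (h1 : f n m ∈ K)
    (h2 : f (n + 1) m ∈ K) (h3 : f (n + 1) (m + 1) ∈ K) (h4 : f n (m + 1) ∈ K) :
    hull f n m ⊆ K := by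
  refine convexHull_min ?_ hK
  intro z hz
  simp only [Set.mem_insert_iff, Set.mem_singleton_iff] at hz
  rcases hz with rfl | rfl | rfl | rfl <;> assumption

/-! ### Disjointness of adjacent cells of a kite map. -/

namespace KiteMap

variable {f : ℕ → ℕ → ℂ} {ρ : ℕ → ℕ → ℝ} {ε : ℕ → ℕ → ℂ}

theorem dir_ne_zero (K : KiteMap f ρ ε) {n m : ℕ} (h : Odd (n + m)) : ε n m ≠ 0 := by
  rw [← norm_pos_iff, K.norm_eq n m h]; exact one_pos

theorem isKite_odd (K : KiteMap f ρ ε) {n m : ℕ} (h : Odd (n + m)) :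
    IsKite (f n m) (f (n + 1) m) (f (n + 1) (m + 1)) (f n (m + 1)) (ε n m) (ε (n + 1) (m + 1))
      (ρ (n + 1) m) (ρ n (m + 1)) := by
  have e1 : Even (n + 1 + m) := by rw [Nat.odd_iff] at h; rw [Nat.even_iff]; omega
  have e2 : Even (n + (m + 1)) := by rw [Nat.odd_iff] at h; rw [Nat.even_iff]; omega
  exact ⟨K.pos _ _ e1 (by simp), K.pos _ _ e2 (by simp),
    by linear_combination K.hor_odd n m h, by linear_combination K.ver_odd n m h,
    by linear_combination K.ver_even _ _ e1 (by simp),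
    by linear_combination K.hor_even _ _ e2 (by simp)⟩

theorem isKite_even (K : KiteMap f ρ ε) {n m : ℕ} (h : Even (n + m)) (h0 : (n, m) ≠ (0, 0)) :
    IsKite (f (n + 1) m) (f (n + 1) (m + 1)) (f n (m + 1)) (f n m) (Complex.I * ε (n + 1) m)
      (Complex.I * ε n (m + 1)) (ρ (n + 1) (m + 1)) (ρ n m) := by
  have e1 : Odd (n + 1 + m) := by rw [Nat.even_iff] at h; rw [Nat.odd_iff]; omega
  have e2 : Odd (n + (m + 1)) := by rw [Nat.even_iff] at h; rw [Nat.odd_iff]; omega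
  have e3 : Even (n + 1 + (m + 1)) := by rw [Nat.even_iff] at *; omega
  have h1 := K.ver_odd (n + 1) m e1
  have h2 := K.hor_even n m h h0
  have h3 := K.hor_odd n (m + 1) e2
  have h4 := K.ver_even n m h h0
  exact ⟨K.pos _ _ e3 (by simp), K.pos _ _ h h0, by linear_combination h1,
    by linear_combination -h2 - (ε (n + 1) m * ρ n m : ℂ) * Complex.I_sq,
    by linear_combination -h3 - (ε n (m + 1) * ρ (n + 1) (m + 1) : ℂ) * Complex.I_sq,
    by linear_combination h4⟩

/-- In the cone lemmas the suffix is the compass position of the cell as seen from the apex. The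
apex is an intersection point for `cone_*` and a center for `center_cone_*`. -/
theorem cone_ne (K : KiteMap f ρ ε) {n m : ℕ} (h : Odd (n + m)) :
    hull f n m ⊆ cone (f n m) (ε n m) (Complex.I * ε n m) := by
  obtain ⟨a, b, c, d⟩ := (K.isKite_odd h).mem_cone_odd
  exact hull_subset (convex_cone _ _ _) a b c d

theorem cone_sw (K : KiteMap f ρ ε) {n m : ℕ} (h : Odd (n + m)) :
    hull f n m ⊆ cone (f (n + 1) (m + 1)) (-ε (n + 1) (m + 1))
      (Complex.I * -ε (n + 1) (m + 1)) := by
  obtain ⟨a, b, c, d⟩ := (K.isKite_odd h).symm.mem_cone_odd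
  exact hull_subset (convex_cone _ _ _) c d a b

theorem cone_nw (K : KiteMap f ρ ε) {n m : ℕ} (h : Even (n + m)) (h0 : (n, m) ≠ (0, 0)) :
    hull f n m ⊆ cone (f (n + 1) m) (Complex.I * ε (n + 1) m)
      (Complex.I * (Complex.I * ε (n + 1) m)) := by
  obtain ⟨a, b, c, d⟩ := (K.isKite_even h h0).mem_cone_odd
  exact hull_subset (convex_cone _ _ _) d a b c

theorem cone_se (K : KiteMap f ρ ε) {n m : ℕ} (h : Even (n + m)) (h0 : (n, m) ≠ (0, 0)) :
    hull f n m ⊆ cone (f n (m + 1)) (-(Complex.I * ε n (m + 1)))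
      (Complex.I * -(Complex.I * ε n (m + 1))) := by
  obtain ⟨a, b, c, d⟩ := (K.isKite_even h h0).symm.mem_cone_odd
  exact hull_subset (convex_cone _ _ _) b c d a

theorem center_cone_nw (K : KiteMap f ρ ε) {n m : ℕ} (h : Odd (n + m)) :
    hull f n m ⊆ cone (f (n + 1) m) (Complex.I * ε (n + 1) (m + 1)) (-ε n m) := by
  obtain ⟨a, b, c, d⟩ := (K.isKite_odd h).mem_cone_even
  exact hull_subset (convex_cone _ _ _) a b c d

theorem center_cone_se (K : KiteMap f ρ ε) {n m : ℕ} (h : Odd (n + m)) :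
    hull f n m ⊆ cone (f n (m + 1)) (Complex.I * -ε n m) (-(-ε (n + 1) (m + 1))) := by
  obtain ⟨a, b, c, d⟩ := (K.isKite_odd h).symm.mem_cone_even
  exact hull_subset (convex_cone _ _ _) c d a b

theorem center_cone_sw (K : KiteMap f ρ ε) {n m : ℕ} (h : Even (n + m)) (h0 : (n, m) ≠ (0, 0)) :
    hull f n m ⊆ cone (f (n + 1) (m + 1)) (Complex.I * (Complex.I * ε n (m + 1)))
      (-(Complex.I * ε (n + 1) m)) := by
  obtain ⟨a, b, c, d⟩ := (K.isKite_even h h0).mem_cone_even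
  exact hull_subset (convex_cone _ _ _) d a b c

theorem center_cone_ne (K : KiteMap f ρ ε) {n m : ℕ} (h : Even (n + m)) (h0 : (n, m) ≠ (0, 0)) :
    hull f n m ⊆ cone (f n m) (Complex.I * -(Complex.I * ε (n + 1) m))
      (-(-(Complex.I * ε n (m + 1)))) := by
  obtain ⟨a, b, c, d⟩ := (K.isKite_even h h0).symm.mem_cone_even
  exact hull_subset (convex_cone _ _ _) b c d a

/-- A common edge has exactly one endpoint that is an intersection point; there the two cells lie in
neighboring quadrants. -/
theorem disjoint_right (K : KiteMap f ρ ε) {n m : ℕ} (h0 : (n, m) ≠ (0, 0)) :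
    Disjoint (interior (hull f n m)) (interior (hull f (n + 1) m)) := by
  rcases Nat.even_or_odd (n + m) with h | h
  · have o : Odd (n + 1 + m) := by rw [Nat.even_iff] at h; rw [Nat.odd_iff]; omega
    have hn := K.dir_ne_zero o
    refine (disjoint_interior_of_cones (K.cone_ne o) (K.cone_nw h h0) hn ?_ ?_ ?_ ?_ ?_).symm
    · simpa using hn
    all_goals simp [side]; nlinarith [sq_nonneg (ε (n + 1) m).re, sq_nonneg (ε (n + 1) m).im]
  · have o : Odd (n + 1 + (m + 1)) := by rw [Nat.odd_iff] at *; omega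
    have ev : Even (n + 1 + m) := by rw [Nat.odd_iff] at h; rw [Nat.even_iff]; omega
    have hn := K.dir_ne_zero o
    refine disjoint_interior_of_cones (K.cone_sw h) (K.cone_se ev (by simp)) ?_ ?_ ?_ ?_ ?_ ?_
    · simpa using hn
    · simpa using hn
    all_goals
      simp [side]
      nlinarith [sq_nonneg (ε (n + 1) (m + 1)).re, sq_nonneg (ε (n + 1) (m + 1)).im]

theorem disjoint_up (K : KiteMap f ρ ε) {n m : ℕ} (h0 : (n, m) ≠ (0, 0)) :
    Disjoint (interior (hull f n m)) (interior (hull f n (m + 1))) := by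
  rcases Nat.even_or_odd (n + m) with h | h
  · have o : Odd (n + (m + 1)) := by rw [Nat.even_iff] at h; rw [Nat.odd_iff]; omega
    have hn := K.dir_ne_zero o
    refine disjoint_interior_of_cones (K.cone_se h h0) (K.cone_ne o) ?_ hn ?_ ?_ ?_ ?_
    · simpa using hn
    all_goals simp [side]; nlinarith [sq_nonneg (ε n (m + 1)).re, sq_nonneg (ε n (m + 1)).im]
  · have o : Odd (n + 1 + (m + 1)) := by rw [Nat.odd_iff] at *; omega
    have ev : Even (n + (m + 1)) := by rw [Nat.odd_iff] at h; rw [Nat.even_iff]; omega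
    have hn := K.dir_ne_zero o
    refine (disjoint_interior_of_cones (K.cone_nw ev (by simp)) (K.cone_sw h) ?_ ?_ ?_ ?_ ?_ ?_).symm
    · simpa using hn
    · simpa using hn
    all_goals
      simp [side]
      nlinarith [sq_nonneg (ε (n + 1) (m + 1)).re, sq_nonneg (ε (n + 1) (m + 1)).im]

theorem side_ne (K : KiteMap f ρ ε) {n m : ℕ} (h : Even (n + m)) (h0 : (n, m) ≠ (0, 0)) :
    0 ≤ side (ε (n + 1) m) (Complex.I * ε n (m + 1)) := by
  have := (K.isKite_even h h0).symm.side_nonneg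
  simp [side] at this ⊢
  linarith

theorem side_sw (K : KiteMap f ρ ε) {n m : ℕ} (h : Even (n + m)) (h0 : (n, m) ≠ (0, 0)) :
    0 ≤ side (ε n (m + 1)) (Complex.I * ε (n + 1) m) := by
  have := (K.isKite_even h h0).side_nonneg
  simp [side] at this ⊢
  linarith

theorem side_nw (K : KiteMap f ρ ε) {n m : ℕ} (h : Odd (n + m)) :
    0 ≤ side (Complex.I * ε (n + 1) (m + 1)) (-ε n m) := (K.isKite_odd h).side_nonneg

/-- If the common vertex is a center, the cyclic order of the two cones follows from the angles of
the two kites between them. -/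
theorem disjoint_diag (K : KiteMap f ρ ε) {n m : ℕ} (h0 : (n, m) ≠ (0, 0)) :
    Disjoint (interior (hull f n m)) (interior (hull f (n + 1) (m + 1))) := by
  rcases Nat.even_or_odd (n + m) with h | h
  · have ev : Even (n + 1 + (m + 1)) := by rw [Nat.even_iff] at *; omega
    have o1 : Odd (n + (m + 1)) := by rw [Nat.even_iff] at h; rw [Nat.odd_iff]; omega
    have o2 : Odd (n + 1 + m) := by rw [Nat.even_iff] at h; rw [Nat.odd_iff]; omega
    have o3 : Odd (n + 1 + 1 + (m + 1)) := by rw [Nat.even_iff] at h; rw [Nat.odd_iff]; omega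
    have s1 := K.side_sw h h0
    have s2 := K.side_ne ev (by simp)
    have s3 := K.side_nw o1
    have s4 := K.side_nw o2
    refine disjoint_interior_of_cones (K.center_cone_sw h h0) (K.center_cone_ne ev (by simp))
      ?_ ?_ ?_ ?_ ?_ ?_
    · simpa using K.dir_ne_zero o1
    · simpa using K.dir_ne_zero o3
    all_goals simp [side] at s1 s2 s3 s4 ⊢; linarith
  · have o : Odd (n + 1 + (m + 1)) := by rw [Nat.odd_iff] at *; omega
    have hn := K.dir_ne_zero o
    refine disjoint_interior_of_cones (K.cone_sw h) (K.cone_ne o) ?_ hn ?_ ?_ ?_ ?_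
    · simpa using hn
    all_goals
      simp [side]
      nlinarith [sq_nonneg (ε (n + 1) (m + 1)).re, sq_nonneg (ε (n + 1) (m + 1)).im]

/-- One of the kites around the center (1, 1) would be the cell at the origin, which is not a kite;
`h00` replaces its angle condition. -/
theorem disjoint_antidiag (K : KiteMap f ρ ε) (h00 : 0 ≤ side (ε 0 1) (Complex.I * ε 1 0))
    {n m : ℕ} : Disjoint (interior (hull f (n + 1) m)) (interior (hull f n (m + 1))) := by
  rcases Nat.even_or_odd (n + m) with h | h
  · have ev : Even (n + 1 + (m + 1)) := by rw [Nat.even_iff] at *; omega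
    have o1 : Odd (n + (m + 1)) := by rw [Nat.even_iff] at h; rw [Nat.odd_iff]; omega
    have o2 : Odd (n + 1 + m) := by rw [Nat.even_iff] at h; rw [Nat.odd_iff]; omega
    have o3 : Odd (n + 1 + (m + 1 + 1)) := by rw [Nat.even_iff] at h; rw [Nat.odd_iff]; omega
    have s1 : 0 ≤ side (ε n (m + 1)) (Complex.I * ε (n + 1) m) := by
      by_cases h0 : (n, m) = (0, 0)
      · simp only [Prod.mk.injEq] at h0
        obtain ⟨rfl, rfl⟩ := h0
        exact h00
      · exact K.side_sw h h0
    have s2 := K.side_ne ev (by simp)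
    have s3 := K.side_nw o1
    have s4 := K.side_nw o2
    refine disjoint_interior_of_cones (K.center_cone_se o2) (K.center_cone_nw o1)
      ?_ ?_ ?_ ?_ ?_ ?_
    · simpa using K.dir_ne_zero o2
    · simpa using K.dir_ne_zero o3
    all_goals simp [side] at s1 s2 s3 s4 ⊢; linarith
  · have o : Odd (n + 1 + (m + 1)) := by rw [Nat.odd_iff] at *; omega
    have e1 : Even (n + (m + 1)) := by rw [Nat.odd_iff] at h; rw [Nat.even_iff]; omega
    have e2 : Even (n + 1 + m) := by rw [Nat.odd_iff] at h; rw [Nat.even_iff]; omega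
    have hn := K.dir_ne_zero o
    refine disjoint_interior_of_cones (K.cone_se e2 (by simp)) (K.cone_nw e1 (by simp))
      ?_ ?_ ?_ ?_ ?_ ?_
    · simpa using hn
    · simpa using hn
    all_goals
      simp [side]
      nlinarith [sq_nonneg (ε (n + 1) (m + 1)).re, sq_nonneg (ε (n + 1) (m + 1)).im]

theorem disjoint_interior_hull (K : KiteMap f ρ ε)
    (h00 : 0 ≤ side (ε 0 1) (Complex.I * ε 1 0)) {n m k l : ℕ} (h : AdjacentCells n m k l)
    (h1 : (n, m) ≠ (0, 0)) (h2 : (k, l) ≠ (0, 0)) :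
    Disjoint (interior (hull f n m)) (interior (hull f k l)) := by
  obtain ⟨hne, a, b, c, d⟩ := h
  have hne' : ¬ (n = k ∧ m = l) := by simpa using hne
  rcases (by omega : (k = n + 1 ∧ l = m) ∨ (n = k + 1 ∧ m = l) ∨ (k = n ∧ l = m + 1) ∨
    (n = k ∧ m = l + 1) ∨ (k = n + 1 ∧ l = m + 1) ∨ (n = k + 1 ∧ m = l + 1) ∨
    (k = n + 1 ∧ m = l + 1) ∨ (n = k + 1 ∧ l = m + 1)) with
    ⟨rfl, rfl⟩ | ⟨rfl, rfl⟩ | ⟨rfl, rfl⟩ | ⟨rfl, rfl⟩ | ⟨rfl, rfl⟩ | ⟨rfl, rfl⟩ | ⟨rfl, rfl⟩ |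
    ⟨rfl, rfl⟩
  · exact K.disjoint_right h1
  · exact (K.disjoint_right h2).symm
  · exact K.disjoint_up h1
  · exact (K.disjoint_up h2).symm
  · exact K.disjoint_diag h1
  · exact (K.disjoint_diag h2).symm
  · exact (K.disjoint_antidiag h00).symm
  · exact K.disjoint_antidiag h00

theorem right_ne (K : KiteMap f ρ ε) {n m : ℕ} (h0 : (n, m) ≠ (0, 0)) :
    f n m ≠ f (n + 1) m := by
  rw [ne_comm, ← sub_ne_zero]
  rcases Nat.even_or_odd (n + m) with h | h
  · rw [K.hor_even n m h h0]
    have o : Odd (n + 1 + m) := by rw [Nat.even_iff] at h; rw [Nat.odd_iff]; omega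
    exact mul_ne_zero (K.dir_ne_zero o) (by exact_mod_cast (K.pos n m h h0).ne')
  · rw [K.hor_odd n m h]
    have ev : Even (n + 1 + m) := by rw [Nat.odd_iff] at h; rw [Nat.even_iff]; omega
    exact mul_ne_zero (K.dir_ne_zero h) (by exact_mod_cast (K.pos _ m ev (by simp)).ne')

theorem up_ne (K : KiteMap f ρ ε) {n m : ℕ} (h0 : (n, m) ≠ (0, 0)) :
    f n m ≠ f n (m + 1) := by
  rw [ne_comm, ← sub_ne_zero]
  rcases Nat.even_or_odd (n + m) with h | h
  · rw [K.ver_even n m h h0]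
    have o : Odd (n + (m + 1)) := by rw [Nat.even_iff] at h; rw [Nat.odd_iff]; omega
    exact mul_ne_zero (mul_ne_zero Complex.I_ne_zero (K.dir_ne_zero o))
      (by exact_mod_cast (K.pos n m h h0).ne')
  · rw [K.ver_odd n m h]
    have ev : Even (n + (m + 1)) := by rw [Nat.odd_iff] at h; rw [Nat.even_iff]; omega
    exact mul_ne_zero (mul_ne_zero Complex.I_ne_zero (K.dir_ne_zero h))
      (by exact_mod_cast (K.pos n _ ev (by simp)).ne')

theorem hasRadius (K : KiteMap f ρ ε) {G : ℕ → ℕ → OnePoint ℂ}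
    (hG : ∀ n m, (n, m) ≠ (0, 0) → G n m = (f n m : OnePoint ℂ)) {n m : ℕ} (h : Even (n + m))
    (h0 : (n, m) ≠ (0, 0)) : HasRadius G n m (ρ n m) := by
  refine ⟨f n m, hG n m h0, fun k l hkl => ⟨f k l, hG k l ?_, ?_⟩⟩
  · rintro hc
    simp only [Prod.mk.injEq] at hc
    rw [Nat.even_iff] at h
    unfold Neighbors at hkl
    omega
  · have hp := K.pos n m h h0
    rw [Nat.even_iff] at h
    rcases hkl with ⟨rfl, rfl | rfl⟩ | ⟨rfl, rfl | rfl⟩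
    · have o : Odd (n + 1 + l) := by rw [Nat.odd_iff]; omega
      rw [dist_eq_norm, K.hor_even n l (Nat.even_iff.2 h) h0, norm_mul, K.norm_eq _ _ o, one_mul,
        Complex.norm_real, Real.norm_of_nonneg hp.le]
    · have o : Odd (k + l) := by rw [Nat.odd_iff]; omega
      rw [dist_comm, dist_eq_norm, K.hor_odd k l o, norm_mul, K.norm_eq _ _ o, one_mul,
        Complex.norm_real, Real.norm_of_nonneg hp.le]
    · have o : Odd (k + (m + 1)) := by rw [Nat.odd_iff]; omega
      rw [dist_eq_norm, K.ver_even k m (Nat.even_iff.2 h) h0, norm_mul, norm_mul, K.norm_eq _ _ o,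
        Complex.norm_I, one_mul, one_mul, Complex.norm_real, Real.norm_of_nonneg hp.le]
    · have o : Odd (k + l) := by rw [Nat.odd_iff]; omega
      rw [dist_comm, dist_eq_norm, K.ver_odd k l o, norm_mul, norm_mul, K.norm_eq _ _ o,
        Complex.norm_I, one_mul, one_mul, Complex.norm_real, Real.norm_of_nonneg hp.le]

end KiteMap
end DiscreteConformal

/-! ### Uniqueness. -/

namespace DiscreteConformal

/-- Three initial values are needed: for Z² the constraint at the second point of an axis is 0 = 0.
-/
theorem sequence_unique {α : Type*} {a b : ℕ → α} (h0 : b 0 = a 0) (h1 : b 1 = a 1)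
    (h2 : b 2 = a 2)
    (step : ∀ n, b (n + 1) = a (n + 1) → b (n + 2) = a (n + 2) → b (n + 3) = a (n + 3)) (n : ℕ) :
    b n = a n := by
  have key : ∀ n, b (n + 1) = a (n + 1) ∧ b (n + 2) = a (n + 2) := by
    intro n
    induction n with
    | zero => exact ⟨h1, h2⟩
    | succ n ih => exact ⟨ih.2, step n ih.1 ih.2⟩
  rcases n with _ | n
  · exact h0
  · exact (key n).1

theorem grid_unique {α : Type*} {f g : ℕ → ℕ → α} (hor : ∀ n, g n 0 = f n 0)
    (ver : ∀ m, g 0 m = f 0 m)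
    (step : ∀ n m, g n m = f n m → g (n + 1) m = f (n + 1) m → g n (m + 1) = f n (m + 1) →
      g (n + 1) (m + 1) = f (n + 1) (m + 1)) : g = f := by
  have key : ∀ m n, g n m = f n m := by
    intro m
    induction m with
    | zero => exact hor
    | succ m ih =>
      intro n
      induction n with
      | zero => exact ver _
      | succ n ihn => exact step n m (ih n) (ih (n + 1)) ihn
  funext n m
  exact key m n

/-- 2a - b - d is the coefficient of c in the equation. If a were the midpoint of b and d, the
fourth point would be ∞, contrary to the existence of a finite c. -/
theorem crossRatio_eq_midpoint {a b c d : ℂ} (hab : a ≠ b)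
    (h : (a - b) * (c - d) = -((b - c) * (d - a))) : 2 * a - b - d ≠ 0 := by
  intro h0
  have h1 : (a - b) * (b - d) = 0 := by linear_combination h + (b - c) * h0
  rcases mul_eq_zero.1 h1 with h2 | h2
  · exact hab (sub_eq_zero.1 h2)
  · exact hab (by linear_combination (h0 - h2) / 2)

theorem crossRatio_unique {a b c c' d : ℂ} (hab : a ≠ b)
    (h : (a - b) * (c - d) = -((b - c) * (d - a)))
    (h' : (a - b) * (c' - d) = -((b - c') * (d - a))) : c' = c := by
  apply mul_left_cancel₀ (crossRatio_eq_midpoint hab h)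
  linear_combination h' - h

/-- The coefficient of c is b - k(b - a). If it vanished, the equation solved by c would give b(b -
a) = 0, hence b = 0 and then k(b - a) = 0. -/
theorem axis_unique {k a b c c' : ℂ} (hk : k ≠ 0) (hab : a ≠ b)
    (h : 2 * b * (c - a) = 2 * k * (c - b) * (b - a))
    (h' : 2 * b * (c' - a) = 2 * k * (c' - b) * (b - a)) : c' = c := by
  have hba : b - a ≠ 0 := sub_ne_zero.2 hab.symm
  have coef : b - k * (b - a) ≠ 0 := by
    intro h0
    have h1 : b * (b - a) = 0 := by linear_combination h / 2 - (c - b) * h0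
    have h2 : b = 0 := (mul_eq_zero.1 h1).resolve_right hba
    have h3 : k * (b - a) = 0 := by linear_combination h2 - h0
    exact mul_ne_zero hk hba h3
  apply mul_left_cancel₀ coef
  linear_combination (h' - h) / 2

/-- The value ∞ would force the coefficient of the finite unknown to vanish. -/
theorem sphere_crossRatio_unique {a b c d : ℂ} {p : OnePoint ℂ} (hab : a ≠ b)
    (h : (a - b) * (c - d) = -((b - c) * (d - a)))
    (h' : hdiff (a : OnePoint ℂ) b * hdiff p d = -(hdiff b p * hdiff (d : OnePoint ℂ) a)) :
    p = c := by
  induction p using OnePoint.rec with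
  | infty =>
    simp only [hdiff_coe, hdiff_infty_coe, hdiff_coe_infty] at h'
    exact absurd (by linear_combination h') (crossRatio_eq_midpoint hab h)
  | coe z =>
    simp only [hdiff_coe] at h'
    rw [crossRatio_unique hab h h']

theorem sphere_axis_unique {k a b c : ℂ} {p : OnePoint ℂ} (hab : a ≠ b)
    (h : c - a = k * (c - b) * (b - a))
    (h' : den (b : OnePoint ℂ) ^ 2 * hdiff p a = k * hdiff p b * hdiff (b : OnePoint ℂ) a) :
    p = c := by
  have coef : 1 - k * (b - a) ≠ 0 := by
    intro h0
    exact hab (by linear_combination (c - b) * h0 - h)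
  induction p using OnePoint.rec with
  | infty =>
    simp only [hdiff_coe, hdiff_infty_coe, den_coe] at h'
    exact absurd (by linear_combination h') coef
  | coe z =>
    simp only [hdiff_coe, den_coe] at h'
    have : z = c := by
      apply mul_left_cancel₀ coef
      linear_combination h' - h
    rw [this]

theorem convex_re_nonneg : Convex ℝ {z : ℂ | 0 ≤ z.re} := by
  intro x hx y hy a b ha hb _
  simp only [Set.mem_ofPred_eq, Complex.add_re, Complex.smul_re, smul_eq_mul] at *
  positivity

theorem convex_re_eq_zero : Convex ℝ {z : ℂ | z.re = 0} := by
  intro x hx y hy a b _ _ _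
  simp only [Set.mem_ofPred_eq, Complex.add_re, Complex.smul_re, smul_eq_mul] at *
  simp [hx, hy]

theorem disjoint_interior_of_re {S T : Set ℂ} (hS : ∀ z ∈ S, 0 ≤ z.re) (hT : ∀ z ∈ T, z.re ≤ 0) :
    Disjoint (interior S) (interior T) :=
  disjoint_interior_of_side (c := 0) (v := -Complex.I) (by simp)
    (fun z hz => by simpa [side] using hS z hz) (fun z hz => by simpa [side] using hT z hz)

theorem cell_toSphere (f : ℕ → ℕ → ℂ) (n m : ℕ) : cell (toSphere f) n m = hull f n m := rfl

theorem cell_infAtOrigin (g : ℕ → ℕ → ℂ) {n m : ℕ} (h : (n, m) ≠ (0, 0)) :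
    cell (infAtOrigin g) n m = hull g n m := by
  unfold cell
  rw [infAtOrigin_of_ne g h, infAtOrigin_succ_left, infAtOrigin_succ_left, infAtOrigin_succ_right]
  rfl

namespace Pattern

variable {R : ℕ → ℕ → ℝ} {e : ℕ → ℕ → ℂ} {g : ℕ → ℕ → ℂ}

theorem z2_unique (P : Pattern R e) {f : ℕ → ℕ → ℂ} (hf : IsZ2 f) : f = z2 R e := by
  have Z := P.isZ2
  have K := P.kiteMap_z2
  refine grid_unique ?_ ?_ ?_
  · refine sequence_unique (hf.init00.trans Z.init00.symm) (hf.init10.trans Z.init10.symm)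
      (hf.init20.trans Z.init20.symm) fun n h1 h2 => ?_
    have c := hf.constraint.horizontal (n + 1)
    rw [show n + 1 + 1 = n + 2 from rfl, h1, h2] at c
    exact axis_unique (Nat.cast_ne_zero.2 (Nat.succ_ne_zero _)) (K.right_ne (by simp))
      (Z.constraint.horizontal (n + 1)) c
  · refine sequence_unique (hf.init00.trans Z.init00.symm) (hf.init01.trans Z.init01.symm)
      (hf.init02.trans Z.init02.symm) fun m h1 h2 => ?_
    have c := hf.constraint.vertical (m + 1)
    rw [show m + 1 + 1 = m + 2 from rfl, h1, h2] at c
    exact axis_unique (Nat.cast_ne_zero.2 (Nat.succ_ne_zero _)) (K.up_ne (by simp))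
      (Z.constraint.vertical (m + 1)) c
  · intro n m h1 h2 h3
    by_cases h0 : (n, m) = (0, 0)
    · simp only [Prod.mk.injEq] at h0
      obtain ⟨rfl, rfl⟩ := h0
      exact hf.init11.trans Z.init11.symm
    · have c := hf.crossRatio n m
      rw [h1, h2, h3] at c
      exact crossRatio_unique (K.right_ne h0) (Z.crossRatio n m) c

theorem log_unique (P : Pattern R e)
    (K : KiteMap g (fun n m => (R n m)⁻¹) (fun n m => (e n m)⁻¹)) (h10 : g 1 0 = 0)
    (h01 : g 0 1 = Complex.I * Real.pi) {G : ℕ → ℕ → OnePoint ℂ} (hG : IsLog G) :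
    G = infAtOrigin g := by
  have L := P.isLog K h10 h01
  refine grid_unique ?_ ?_ ?_
  · refine sequence_unique (hG.init00.trans L.init00.symm) (hG.init10.trans L.init10.symm)
      (hG.init20.trans L.init20.symm) fun n h1 h2 => ?_
    have c := hG.constraint.horizontal (n + 1)
    rw [show n + 1 + 1 = n + 2 from rfl, h1, h2, infAtOrigin_succ_left, infAtOrigin_succ_left] at c
    rw [infAtOrigin_succ_left]
    exact sphere_axis_unique (K.right_ne (by simp)) (P.log_axis_hor K n) c
  · refine sequence_unique (hG.init00.trans L.init00.symm) (hG.init01.trans L.init01.symm)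
      (hG.init02.trans L.init02.symm) fun m h1 h2 => ?_
    have c := hG.constraint.vertical (m + 1)
    rw [show m + 1 + 1 = m + 2 from rfl, h1, h2, infAtOrigin_succ_right,
      infAtOrigin_succ_right] at c
    rw [infAtOrigin_succ_right]
    exact sphere_axis_unique (K.up_ne (by simp)) (P.log_axis_ver K m) c
  · intro n m h1 h2 h3
    by_cases h0 : (n, m) = (0, 0)
    · simp only [Prod.mk.injEq] at h0
      obtain ⟨rfl, rfl⟩ := h0
      exact hG.init11.trans L.init11.symm
    · have c := hG.crossRatio n m
      rw [h1, h2, h3, infAtOrigin_of_ne g h0, infAtOrigin_succ_left, infAtOrigin_succ_right] at c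
      rw [infAtOrigin_succ_left]
      exact sphere_crossRatio_unique (K.right_ne h0) (K.crossRatio h0) c

/-! ### Immersion, including the cell at the origin. -/

theorem isImmersion_z2 (P : Pattern R e) : IsImmersion (toSphere (z2 R e)) := by
  -- Three vertices are 0 and the fourth is 2i/π, so the cell is a segment of the imaginary axis.
  have origin : interior (hull (z2 R e) 0 0) = ∅ := by
    have sub : hull (z2 R e) 0 0 ⊆ {z : ℂ | z.re = 0} := by
      apply hull_subset convex_re_eq_zero
      · simp [P.z2_zero_zero]
      · simp [P.z2_one_zero]
      · have := P.isZ2.init11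
        simp only [zero_add, Set.mem_ofPred_eq, this]
        rw [← Complex.ofReal_ofNat, ← Complex.ofReal_div]
        simp
      · simp [P.z2_zero_one]
    exact disjoint_self.1 (disjoint_interior_of_re (fun z hz => (sub hz).ge)
      fun z hz => (sub hz).le)
  intro n m k l h
  rw [cell_toSphere, cell_toSphere]
  by_cases h1 : (n, m) = (0, 0)
  · simp only [Prod.mk.injEq] at h1
    rw [h1.1, h1.2, origin]
    exact Set.empty_disjoint _
  by_cases h2 : (k, l) = (0, 0)
  · simp only [Prod.mk.injEq] at h2
    rw [h2.1, h2.2, origin]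
    exact Set.disjoint_empty _
  refine P.kiteMap_z2.disjoint_interior_hull ?_ h h1 h2
  simp [side, P.axis_hor odd_one, P.axis_ver odd_one]

/-- All e lie in the closed first quadrant, so 1/e and i/e have nonnegative real parts. Hence Re Log
does not decrease to the right or upwards, and it starts at 0 at (1, 0) and (0, 1). -/
theorem log_re_nonneg (P : Pattern R e)
    (K : KiteMap g (fun n m => (R n m)⁻¹) (fun n m => (e n m)⁻¹)) (h10 : g 1 0 = 0)
    (h01 : g 0 1 = Complex.I * Real.pi) {n m : ℕ} (h0 : (n, m) ≠ (0, 0)) : 0 ≤ (g n m).re := by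
  have dir : ∀ {n m : ℕ}, Odd (n + m) → 0 ≤ ((e n m)⁻¹).re ∧ ((e n m)⁻¹).im ≤ 0 := by
    intro n m h
    rw [Complex.inv_re, Complex.inv_im]
    exact ⟨div_nonneg (P.re_nonneg h) (Complex.normSq_nonneg _),
      div_nonpos_of_nonpos_of_nonneg (neg_nonpos.2 (P.im_nonneg h)) (Complex.normSq_nonneg _)⟩
  have right : ∀ {n m : ℕ}, (n, m) ≠ (0, 0) → (g n m).re ≤ (g (n + 1) m).re := by
    intro n m h0
    rw [← sub_nonneg, ← Complex.sub_re]
    rcases Nat.even_or_odd (n + m) with h | h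
    · have o : Odd (n + 1 + m) := by rw [Nat.even_iff] at h; rw [Nat.odd_iff]; omega
      rw [K.hor_even n m h h0, Complex.re_mul_ofReal]
      exact mul_nonneg (dir o).1 (K.pos n m h h0).le
    · have ev : Even (n + 1 + m) := by rw [Nat.odd_iff] at h; rw [Nat.even_iff]; omega
      rw [K.hor_odd n m h, Complex.re_mul_ofReal]
      exact mul_nonneg (dir h).1 (K.pos _ m ev (by simp)).le
  have up : ∀ {n m : ℕ}, (n, m) ≠ (0, 0) → (g n m).re ≤ (g n (m + 1)).re := by
    intro n m h0
    rw [← sub_nonneg, ← Complex.sub_re]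
    rcases Nat.even_or_odd (n + m) with h | h
    · have o : Odd (n + (m + 1)) := by rw [Nat.even_iff] at h; rw [Nat.odd_iff]; omega
      rw [K.ver_even n m h h0, Complex.re_mul_ofReal, Complex.I_mul_re]
      exact mul_nonneg (neg_nonneg.2 (dir o).2) (K.pos n m h h0).le
    · have ev : Even (n + (m + 1)) := by rw [Nat.odd_iff] at h; rw [Nat.even_iff]; omega
      rw [K.ver_odd n m h, Complex.re_mul_ofReal, Complex.I_mul_re]
      exact mul_nonneg (neg_nonneg.2 (dir h).2) (K.pos n _ ev (by simp)).le
  have axis : ∀ n, 0 ≤ (g (n + 1) 0).re := by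
    intro n
    induction n with
    | zero => simp [h10]
    | succ n ih => exact ih.trans (right (by simp))
  have vaxis : ∀ m, 0 ≤ (g 0 (m + 1)).re := by
    intro m
    induction m with
    | zero => simp [h01]
    | succ m ih => exact ih.trans (up (by simp))
  rcases n with _ | n
  · rcases m with _ | m
    · exact absurd rfl h0
    · exact vaxis m
  · induction m with
    | zero => exact axis n
    | succ m ih => exact (ih (by simp)).trans (up (by simp))

theorem isImmersion_log (P : Pattern R e)
    (K : KiteMap g (fun n m => (R n m)⁻¹) (fun n m => (e n m)⁻¹)) (h10 : g 1 0 = 0)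
    (h01 : g 0 1 = Complex.I * Real.pi) : IsImmersion (infAtOrigin g) := by
  have strip : ∀ z ∈ cell (infAtOrigin g) 0 0, z.re ≤ 0 := by
    have e1 : cell (infAtOrigin g) 0 0 = halfStrip (g 1 0) (g 0 1) := rfl
    rw [e1, h10, h01]
    rintro z ⟨s, -, t, ht, rfl⟩
    simp
    have := Real.pi_pos
    positivity
  have other : ∀ {n m : ℕ}, (n, m) ≠ (0, 0) → ∀ z ∈ cell (infAtOrigin g) n m, 0 ≤ z.re := by
    intro n m h
    rw [cell_infAtOrigin g h]
    exact hull_subset convex_re_nonneg (P.log_re_nonneg K h10 h01 h)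
      (P.log_re_nonneg K h10 h01 (by simp)) (P.log_re_nonneg K h10 h01 (by simp))
      (P.log_re_nonneg K h10 h01 (by simp))
  intro n m k l h
  by_cases h1 : (n, m) = (0, 0)
  · have h2 : (k, l) ≠ (0, 0) := fun hc => h.1 (h1.trans hc.symm)
    simp only [Prod.mk.injEq] at h1
    rw [h1.1, h1.2]
    exact (disjoint_interior_of_re (other h2) strip).symm
  by_cases h2 : (k, l) = (0, 0)
  · have h3 := other h1
    simp only [Prod.mk.injEq] at h2
    rw [h2.1, h2.2]
    exact disjoint_interior_of_re h3 strip
  rw [cell_infAtOrigin g h1, cell_infAtOrigin g h2]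
  refine K.disjoint_interior_hull ?_ h h1 h2
  simp [side, P.axis_hor odd_one, P.axis_ver odd_one]

end Pattern
end DiscreteConformal

theorem proposition6 :
    (∃! f : ℕ → ℕ → ℂ, DiscreteConformal.IsZ2 f) ∧
    (∃! g : ℕ → ℕ → OnePoint ℂ, DiscreteConformal.IsLog g) ∧
    (∀ f : ℕ → ℕ → ℂ, DiscreteConformal.IsZ2 f →
      DiscreteConformal.IsImmersion (DiscreteConformal.toSphere f)) ∧
    (∀ g : ℕ → ℕ → OnePoint ℂ, DiscreteConformal.IsLog g →
      DiscreteConformal.IsImmersion g) ∧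
    (∀ (f : ℕ → ℕ → ℂ) (g : ℕ → ℕ → OnePoint ℂ),
      DiscreteConformal.IsZ2 f → DiscreteConformal.IsLog g →
        ∀ n m : ℕ, Even (n + m) → (n, m) ≠ (0, 0) →
          ∃ r : ℝ, 0 < r ∧
            DiscreteConformal.HasRadius (DiscreteConformal.toSphere f) n m r ∧
            DiscreteConformal.HasRadius g n m r⁻¹) := by
  obtain ⟨R, e, P⟩ := DiscreteConformal.exists_pattern
  obtain ⟨g, K, h10, h01⟩ := P.exists_log
  refine ⟨⟨_, P.isZ2, fun f hf => P.z2_unique hf⟩,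
    ⟨_, P.isLog K h10 h01, fun G hG => P.log_unique K h10 h01 hG⟩, fun f hf => ?_, fun G hG => ?_,
    fun f G hf hG n m h h0 => ⟨R n m, P.pos n m h h0, ?_, ?_⟩⟩
  · rw [P.z2_unique hf]
    exact P.isImmersion_z2
  · rw [P.log_unique K h10 h01 hG]
    exact P.isImmersion_log K h10 h01
  · rw [P.z2_unique hf]
    exact P.kiteMap_z2.hasRadius (fun _ _ _ => rfl) h h0
  · rw [P.log_unique K h10 h01 hG]
    exact K.hasRadius (fun _ _ h => DiscreteConformal.infAtOrigin_of_ne g h) h h0
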